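/- **Background.** Let $0<a<a^*:=3/\big(2(26+15\sqrt3)\big)^{1/3}$, let $\ell\ge 0$ be an integer, $S(z)=(1+az)^{2/3}$, $q(z)=\dfrac{a^2}{6\pi(3+4az+a^2z^2)}$, and let dots denote $d/dz$. (These are the radial function and the density function of the self-similar marginally bound Lemaître–Tolman–Bondi spacetime in the similarity variable $z=-t_{\rm com}/r$, and $\ell$ is the multipole number of an even parity perturbation.) Let $z_c\in(-1/a,0)$ be the Cauchy horizon, i.e. the largest root in $(-1/a,0)$ of $z+S-z\dot S=0$. Write $w=S-z\dot S$, $h_\pm=z\pm w$, $X=S(\dot S+z\ddot S)-z\dot S^2$, $\Lambda=\ell(\ell+1)-2$. Let $\tilde A(z)=\mathrm{diag}(0,0,-1/z,-1/h_-,-1/h_+)$, let $$\sigma(z)=\Big(0,\;0,\;\tfrac{16\pi q w}{zS},\;-\tfrac{8\pi q(1+\dot S)w}{S h_-},\;\tfrac{8\pi q(\dot S-1)w}{S h_+}\Big)^T,$$ and let $\tilde C(z)=(c_{ij})$ be the $5\times5$ matrix with $$c_{11}=\tfrac{-3z(\dot S-1)\dot S^2-S^2\ddot S+S(3\dot S^2-z\ddot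 S+\dot S(-3+2z\ddot S))}{S(\dot S-1)w},\quad c_{12}=\tfrac{1-\dot S}{2S},\quad c_{13}=c_{14}=c_{15}=\tfrac{\dot S-1}{2S},$$ $$c_{21}=-\tfrac{8\pi qS}{\dot S-1},\quad c_{22}=-\tfrac{\dot q}{q},\quad c_{23}=0,\quad c_{24}=-\tfrac{4\pi qS}{\dot S+1},\quad c_{25}=-\tfrac{4\pi qS}{\dot S-1},$$ $$c_{31}=\tfrac{2\left(2z^3\dot S^4-2z^2S\dot S^2(3\dot S+z\ddot S)+S^3(-2\dot S+z^2\dddot S)+zS^2(6\dot S^2+z^2\ddot S^2+z\dot S(2\ddot S-z\dddot S))\right)}{zS(\dot S-1)w^2},\quad c_{32}=-\tfrac2z-\tfrac{\dot q}{q},\quad c_{33}=\tfrac1z+\tfrac{2\dot S}{S},$$ $$c_{34}=\tfrac{z\dot S(-\Lambda+2\dot S+2\dot S^2)-4S^2\ddot S+S(\Lambda-2\dot S^2-2z\ddot S+\dot S(-2+4z\ddot S))}{2zS(1+\dot S)},\quad c_{35}=\tfrac{z\dot S(\Lambda+2\dot S-2\dot S^2)+4S^2\ddot S-S(\Lambda-2\dot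 S^2+2z\ddot S+\dot S(2+4z\ddot S))}{2zS(\dot S-1)},$$ $$c_{41}=\tfrac{4(1+\dot S)X}{S(\dot S-1)h_-},\quad c_{42}=0,\quad c_{43}=c_{45}=\tfrac{(1+\dot S)w}{Sh_-},\quad c_{44}=\tfrac{3+(z+S)\ddot S+\dot S(3+z\ddot S)}{(1+\dot S)h_-},$$ $$c_{51}=-\tfrac{4X}{Sh_+},\quad c_{52}=0,\quad c_{53}=c_{54}=-\tfrac{(\dot S-1)w}{Sh_+},\quad c_{55}=-\tfrac{3+(S-z)\ddot S+\dot S(-3+z\ddot S)}{(\dot S-1)h_+}.$$ **System.** Put $t=z-z_c$, so that the Cauchy horizon is $t=0$, and $A(t)=t\tilde A(z_c+t)$, $C(t)=t\tilde C(z_c+t)$, $h(t)=t\,\sigma(z_c+t)$. Let $c=\lim_{t\to0^+}C_{55}(t)$. For an initial surface $0<t_1<|z_c|$ and data $f\in C_0^\infty(\mathbb R,\mathbb R^5)$, $g\in C_0^\infty(\mathbb R)$, let $u$ be a smooth solution on $(0,t_1]\times\mathbb R$ of $$t\,\partial_tu+A(t)\,\partial_pu+C(t)\,u=h(t)\,g(p),\qquad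 u(t_1,\cdot)=f,$$ with $u(t,\cdot)$ compactly supported for every $t\in(0,t_1]$. Let $x=t^cu$, and for $t\in(0,t_1]$ let $$E_1(t)=\int_{\mathbb R}x\cdot x\,dp,\qquad E_2(t)=\int_{\mathbb R}x\cdot x+(t-1)x_5^2\,dp=\int_{\mathbb R}x_1^2+x_2^2+x_3^2+x_4^2+t\,x_5^2\,dp,$$ and let $E_2(0)=\lim_{t\to0^+}E_2(t)$. **Einstein constraint.** The data satisfy the Einstein constraint if, for all $p$, at $z=z_c+t_1$, $\sum_{i=1}^5g_i(z)f_i(p)+g_6(z)f_3'(p)+g_7(z)g(p)=0$, where $g_6=2S^2w$, $g_7=32\pi qSw^2$, $$g_1=\tfrac{4S\left(-6z^2S\dot S^3+2z^3\dot S^4+4\pi zqS^2w^2+S^3(-2\dot S+z\ddot S)+zS^2(6\dot S^2-z\dot S\ddot S+z^2\ddot S^2)\right)}{(1-\dot S)w},$$ $$g_2=2S\left(2S^2+2z^2\dot S^2+zS(-4\dot S+z\ddot S)\right),\quad g_3=-2S^2\left(S+z(-\dot S+z\ddot S)\right),\quad g_4=-\tfrac{m_1}{1+\dot S},\quad g_5=\tfrac{m_2}{1-\dot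 S},$$ $$m_1=S\big(z^2\dot S(1+\dot S)(\Lambda-2\dot S-2\dot S^2)+S^3(8\pi zq-4\ddot S)-zS(\Lambda-4\dot S^3-2z\ddot S+2\dot S(\Lambda-1+z\ddot S)+\dot S^2(-6+4z\ddot S))+S^2(\Lambda-2\dot S^2+4z\ddot S+\dot S(-2-8\pi z^2q+8z\ddot S))\big),$$ $$m_2=S\big(-z^2(\dot S-1)\dot S(\Lambda+2\dot S-2\dot S^2)+4S^3(2\pi zq+\ddot S)-zS(\Lambda+4\dot S^3+2z\ddot S-2\dot S(\Lambda-1-z\ddot S)-2\dot S^2(3+2z\ddot S))-S^2(\Lambda-2\dot S^2-4z\ddot S+\dot S(2+8\pi z^2q+8z\ddot S))\big).$$ **Theorem.** Fix $a$ and $\ell$. 1. There is $t^*>0$ such that for all $t_1\in(0,|z_c|)$ and all data $(f,g)$ there is $\mu>0$, depending only on $a,\ell,t_1,f,g$, such that $E_1(t)\le\mu/t$ for all $t\in(0,t^*]$ with $t\le t_1$. 2. There are $\mu>0$ and $t^*>0$, depending only on $a$ and $\ell$, such that for every $t_1\in(0,|z_c|)$ and every solution $u$ as above: (i) there is $t_2\in(0,t_1]$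 with $E_2(t)\le E_2(t_2)\,e^{\mu(t_2-t)}$ for all $t\in[0,t_2]$; (ii) for every $t_2\in(0,t^*]$ with $t_2\le t_1$ and every $t\in[0,t_2]$, $E_2(t)\le\big(E_2(t_2)+\mu(t_2-t)\|g\|_{L^2}^2\big)e^{\mu(t_2-t)}$; in particular, if $g=0$, then $E_2(t)\le E_2(t_2)\,e^{\mu(t_2-t)}$ for all $0\le t\le t_2\le\min(t^*,t_1)$. 3. For every $t_1\in(0,|z_c|)$ there is $\nu>0$, depending only on $a,\ell,t_1$, such that for every solution $u$ as above: $E_2$ is continuous on $[0,t_1]$ (in particular the limit defining $E_2(0)$ exists); $E_2(t)\le\nu\big(E_1(t_1)+\|g\|_{L^2}^2\big)$ for all $t\in[0,t_1]$; and if the data satisfy the Einstein constraint, then $E_2(t)\le\nu\,E_1(t_1)$ for all $t\in[0,t_1]$. -/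

import Mathlib

open Set Filter Topology MeasureTheory
open scoped Matrix ContDiff

noncomputable section

namespace LTB

/-! ### The self-similar marginally bound Lemaitre-Tolman-Bondi background -/

/-- The upper bound for the parameter `a` below which the singularity is naked. -/
def aStar : ℝ := 3 / (2 * (26 + 15 * √3)) ^ (1 / 3 : ℝ)

/-- The radial function `S(z) = (1 + a z)^(2/3)`. -/
def S (a z : ℝ) : ℝ := (1 + a * z) ^ (2 / 3 : ℝ)

/-- The density function: the dust density is `q(z) / r^2`. -/
def q (a z : ℝ) : ℝ := a ^ 2 / (6 * Real.pi * (3 + 4 * a * z + a ^ 2 * z ^ 2))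

/-- `zc` is the Cauchy horizon: the first root of `z + S - z S'` met when `z` decreases from `0`
towards the shell-focusing singularity `z = -1/a`. -/
def IsCauchyHorizon (a zc : ℝ) : Prop :=
  IsGreatest {z : ℝ | -1 / a < z ∧ z < 0 ∧ z + S a z - z * deriv (S a) z = 0} zc

/-! ### The five dimensional system, in the similarity variable `z`

`D`, `E`, `F` are the first three derivatives of `S`, and `r` is `q' / q`. -/

/-- Coefficient of the `p`-derivative. -/
def Atilde (a z : ℝ) : Matrix (Fin 5) (Fin 5) ℝ :=
  let D := deriv (S a) z
  let S := S a z
  Matrix.diagonal ![0, 0, -(1 / z), -(z - S + z * D)⁻¹, -(z + S - z * D)⁻¹]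

/-- Coefficient of the undifferentiated term, for the multipole number `l`. -/
def Ctilde (a : ℝ) (l : ℕ) (z : ℝ) : Matrix (Fin 5) (Fin 5) ℝ :=
  let L : ℝ := l
  let D := deriv (S a) z
  let E := iteratedDeriv 2 (S a) z
  let F := iteratedDeriv 3 (S a) z
  let r := deriv (q a) z / q a z
  let S := S a z
  let q := q a z
  let π := Real.pi
  let n1 := 2 * (2 * z ^ 3 * D ^ 4 - 2 * z ^ 2 * S * D ^ 2 * (3 * D + z * E)
    + S ^ 3 * (-2 * D + z ^ 2 * F)
    + z * S ^ 2 * (6 * D ^ 2 + z ^ 2 * E ^ 2 + z * D * (2 * E - z * F)))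
  let n2 := z * D * (2 - L - L ^ 2 + 2 * D + 2 * D ^ 2) - 4 * S ^ 2 * E
    + S * (-2 + L + L ^ 2 - 2 * D ^ 2 - 2 * z * E + D * (-2 + 4 * z * E))
  let n3 := z * D * (-2 + L + L ^ 2 + 2 * D - 2 * D ^ 2) + 4 * S ^ 2 * E
    - S * (-2 + L + L ^ 2 - 2 * D ^ 2 + 2 * z * E + D * (2 + 4 * z * E))
  !![(-3 * z * (-1 + D) * D ^ 2 - S ^ 2 * E + S * (3 * D ^ 2 - z * E + D * (-3 + 2 * z * E)))
        / (S * (-1 + D) * (S - z * D)),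
      -((-1 + D) / (2 * S)),
      (-1 + D) / (2 * S),
      (-1 + D) / (2 * S),
      (-1 + D) / (2 * S);
    -(8 * π * q * S / (-1 + D)),
      -r,
      0,
      -(4 * π * q * S / (1 + D)),
      -(4 * π * q * S / (-1 + D));
    n1 / (z * S * (-1 + D) * (S - z * D) ^ 2),
      -(2 / z) - r,
      1 / z + 2 * D / S,
      n2 / (2 * z * S * (1 + D)),
      n3 / (2 * z * S * (-1 + D));
    4 * (1 + D) * (-z * D ^ 2 + S * (D + z * E)) / (S * (-1 + D) * (z - S + z * D)),
      0,
      (1 + D) * (S - z * D) / (S * (z - S + z * D)),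
      (3 + (z + S) * E + D * (3 + z * E)) / ((1 + D) * (z - S + z * D)),
      (1 + D) * (S - z * D) / (S * (z - S + z * D));
    -(4 * (-z * D ^ 2 + S * (D + z * E)) / (S * (z + S - z * D))),
      0,
      -((-1 + D) * (S - z * D) / (S * (z + S - z * D))),
      -((-1 + D) * (S - z * D) / (S * (z + S - z * D))),
      -((3 + (-z + S) * E + D * (-3 + z * E)) / ((-1 + D) * (z + S - z * D)))]

/-- The `z`-dependent factor of the source. -/
def sourceTilde (a z : ℝ) : Fin 5 → ℝ :=
  let D := deriv (S a) z
  let S := S a z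
  let q := q a z
  let π := Real.pi
  ![0,
    0,
    -(16 * π * q * (-S + z * D) / (z * S)),
    -(8 * π * q * (1 + D) * (S - z * D) / (S * (z - S + z * D))),
    8 * π * q * (-1 + D) * (S - z * D) / (S * (z + S - z * D))]

/-- The coefficients of `u_1, ..., u_5` in the Einstein constraint. -/
def constraintCoeff (a : ℝ) (l : ℕ) (z : ℝ) : Fin 5 → ℝ :=
  let L : ℝ := l
  let D := deriv (S a) z
  let E := iteratedDeriv 2 (S a) z
  let S := S a z
  let q := q a z
  let π := Real.pi
  let m1 := S * (z ^ 2 * D * (1 + D) * (-2 + L + L ^ 2 - 2 * D - 2 * D ^ 2)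
    + S ^ 3 * (8 * π * z * q - 4 * E)
    - z * S * (-2 + L + L ^ 2 - 4 * D ^ 3 - 2 * z * E + 2 * D * (-3 + L + L ^ 2 + z * E)
      + D ^ 2 * (-6 + 4 * z * E))
    + S ^ 2 * (-2 + L + L ^ 2 - 2 * D ^ 2 + 4 * z * E
      + D * (-2 - 8 * π * z ^ 2 * q + 8 * z * E)))
  let m2 := S * (-z ^ 2 * (-1 + D) * D * (-2 + L + L ^ 2 + 2 * D - 2 * D ^ 2)
    + 4 * S ^ 3 * (2 * π * z * q + E)
    - z * S * (-2 + L + L ^ 2 + 4 * D ^ 3 + 2 * z * E - 2 * D * (-3 + L + L ^ 2 - z * E)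
      - 2 * D ^ 2 * (3 + 2 * z * E))
    - S ^ 2 * (-2 + L + L ^ 2 - 2 * D ^ 2 - 4 * z * E
      + D * (2 + 8 * π * z ^ 2 * q + 8 * z * E)))
  ![4 * S * (-6 * z ^ 2 * S * D ^ 3 + 2 * z ^ 3 * D ^ 4
        + 4 * π * z * q * S ^ 2 * (S - z * D) ^ 2 + S ^ 3 * (-2 * D + z * E)
        + z * S ^ 2 * (6 * D ^ 2 - z * D * E + z ^ 2 * E ^ 2)) / ((-1 + D) * (-S + z * D)),
    2 * S * (2 * S ^ 2 + 2 * z ^ 2 * D ^ 2 + z * S * (-4 * D + z * E)),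
    -2 * S ^ 2 * (S + z * (-D + z * E)),
    -(m1 / (1 + D)),
    m2 / (1 - D)]

/-- The coefficient of the `p`-derivative of `u_3` in the Einstein constraint. -/
def constraintCoeffDeriv (a z : ℝ) : ℝ :=
  2 * S a z ^ 2 * (S a z - z * deriv (S a) z)

/-- The coefficient of the velocity data `g` in the Einstein constraint. -/
def constraintCoeffSource (a z : ℝ) : ℝ :=
  32 * Real.pi * q a z * S a z * (S a z - z * deriv (S a) z) ^ 2

/-- The data `f` for `u` on the surface `z` and the velocity data `g` satisfy the Einstein
constraint. -/
def EinsteinConstraint (a : ℝ) (l : ℕ) (z : ℝ) (f : ℝ → Fin 5 → ℝ) (g : ℝ → ℝ) : Prop :=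
  ∀ p : ℝ, constraintCoeff a l z ⬝ᵥ f p + constraintCoeffDeriv a z * deriv (fun s => f s 2) p
    + constraintCoeffSource a z * g p = 0

/-! ### The system in the variable `t = z - zc` -/

def A (a zc t : ℝ) : Matrix (Fin 5) (Fin 5) ℝ := t • Atilde a (zc + t)

def C (a : ℝ) (l : ℕ) (zc t : ℝ) : Matrix (Fin 5) (Fin 5) ℝ := t • Ctilde a l (zc + t)

/-- The source is `source a zc t` times `g p`. -/
def source (a zc t : ℝ) : Fin 5 → ℝ := t • sourceTilde a (zc + t)

/-- The exponent `c` is the limit of the `(5,5)` entry of `C(t)` on the Cauchy horizon, i.e. the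
nonzero eigenvalue of `C(0)`. -/
def IsExponent (a : ℝ) (l : ℕ) (zc c : ℝ) : Prop :=
  Tendsto (fun t => C a l zc t 4 4) (𝓝[>] 0) (𝓝 c)

/-- `φ` is smooth with compact support. -/
def IsTest {V : Type*} [NormedAddCommGroup V] [NormedSpace ℝ V] (φ : ℝ → V) : Prop :=
  ContDiff ℝ ∞ φ ∧ HasCompactSupport φ

/-- `u` is the smooth solution on `(0, t₁] × ℝ`, with compactly supported time slices, of
`t u_t + A(t) u_p + C(t) u = source(t) g(p)` with `u(t₁, ·) = f`. -/
structure IsSolution (a : ℝ) (l : ℕ) (zc t₁ : ℝ) (f : ℝ → Fin 5 → ℝ) (g : ℝ → ℝ)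
    (u : ℝ → ℝ → Fin 5 → ℝ) : Prop where
  smooth : ContDiffOn ℝ ∞ (fun y : ℝ × ℝ => u y.1 y.2) (Ioc 0 t₁ ×ˢ univ)
  compact_slices : ∀ t ∈ Ioc 0 t₁, HasCompactSupport (u t)
  initial : u t₁ = f
  equation : ∀ t ∈ Ioc 0 t₁, ∀ p : ℝ,
    t • derivWithin (fun s => u s p) (Ioc 0 t₁) t + A a zc t *ᵥ deriv (u t) p
      + C a l zc t *ᵥ u t p = g p • source a zc t

/-! ### The energies -/

/-- The scaled vector `x = t^c u`. -/
def x (c : ℝ) (u : ℝ → ℝ → Fin 5 → ℝ) (t p : ℝ) : Fin 5 → ℝ := t ^ c • u t p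

def E₁ (c : ℝ) (u : ℝ → ℝ → Fin 5 → ℝ) (t : ℝ) : ℝ := ∫ p, x c u t p ⬝ᵥ x c u t p

/-- The integral defining the second energy, away from the Cauchy horizon. -/
def E₂pos (c : ℝ) (u : ℝ → ℝ → Fin 5 → ℝ) (t : ℝ) : ℝ :=
  ∫ p, (x c u t p ⬝ᵥ x c u t p + (t - 1) * x c u t p 4 ^ 2)

open Classical in
/-- The second energy. As `u` is only given for `t > 0`, the value on the Cauchy horizon `t = 0`
is the limit. -/
def E₂ (c : ℝ) (u : ℝ → ℝ → Fin 5 → ℝ) (t : ℝ) : ℝ :=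
  if t = 0 then limUnder (𝓝[>] 0) (E₂pos c u) else E₂pos c u t

end LTB

end

/-! Dividing the system by `t` turns it into five scalar transport equations, coupled only through
undifferentiated terms. The spatial matrix is diagonal and depends on time only, so transport terms
integrate to zero in any energy with `p`-independent weights. The speed of `u_5`, which blows up at
the horizon, therefore does no harm.

At the horizon only `h_+` vanishes, and it divides only the fifth row. Hence the first four rows of
`C` and of the source are `O(t)`, while the fifth is bounded and its diagonal entry tends to `c`.
Writing `d` for the derivative of `h_+` at the horizon, the existence of this limit forces `d > 0`,
and `c = 2 + 1/d ≥ 2`.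

With `P` the sum of the squares of the first four components and `y` the fifth, the density of
`dE_2/dt` is `t^(2c-1)` times `2cP + t(1 + 2(c - C_55))y²` plus cross terms carrying a factor `t`.
The extra weight `t` on `y²` supplies the 1 in the bracket. Near the horizon both squares then have
positive coefficients and absorb the cross terms, leaving a loss of order `t‖g‖²`
(`near_quadratic_bound`). So `E_2` is nondecreasing in `t` up to a source term
(`IsCauchyHorizon.exists_energy_near`). This gives its limit at `t = 0` and the local bounds; away
from the horizon Grönwall suffices. The bound on `E_1` follows from `t E_1 ≤ E_2` for `t ≤ 1`.

The constraint expresses `g` as a multiple `β f_3'` plus a term bounded pointwise by the data. The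
derivative `f_3'` is not controlled by `E_1(t_1)`. It is removed by subtracting `β κ(z) f_3(p)` from
`u`, where `κ` is the source divided by the speeds; the transport operator applied to this
correction reproduces the bad source, and what remains is of order zero in the data. -/

namespace LTB

/-! ### Energy identities for diagonal transport systems -/

section EnergyCalculus

variable {s T R : ℝ}

/-- Differentiation of the integral of a compactly supported density; a spatial transport term
integrates to zero. -/
theorem hasDerivAt_integral_transport {Ψ : ℝ × ℝ → ℝ} (hΨ : ContDiffOn ℝ 1 Ψ (Ioo s T ×ˢ univ))
    (hR : ∀ t ∈ Ioo s T, ∀ p, R < |p| → Ψ (t, p) = 0) (b : ℝ) {t : ℝ} (ht : t ∈ Ioo s T) :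
    Integrable (fun p => fderiv ℝ Ψ (t, p) (1, b)) ∧
    HasDerivAt (fun t => ∫ p, Ψ (t, p)) (∫ p, fderiv ℝ Ψ (t, p) (1, b)) t := by
  have hopen : IsOpen (Ioo s T ×ˢ (univ : Set ℝ)) := isOpen_Ioo.prod isOpen_univ
  have hmem : ∀ {τ : ℝ}, τ ∈ Ioo s T → ∀ p : ℝ, (τ, p) ∈ Ioo s T ×ˢ (univ : Set ℝ) :=
    fun h p => ⟨h, mem_univ p⟩
  have hdiff : ∀ {τ : ℝ}, τ ∈ Ioo s T → ∀ p : ℝ, HasFDerivAt Ψ (fderiv ℝ Ψ (τ, p)) (τ, p) :=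
    fun {τ} h p => ((hΨ.contDiffAt (hopen.mem_nhds (hmem h p))).differentiableAt
      one_ne_zero).hasFDerivAt
  have hcf : ContinuousOn (fderiv ℝ Ψ) (Ioo s T ×ˢ univ) :=
    hΨ.continuousOn_fderiv_of_isOpen hopen le_rfl
  have hcont : ∀ τ ∈ Ioo s T, Continuous fun p => Ψ (τ, p) := fun τ hτ =>
    hΨ.continuousOn.comp_continuous (by fun_prop) (hmem hτ)
  have hcontD : ∀ τ ∈ Ioo s T, ∀ v : ℝ × ℝ, Continuous fun p => fderiv ℝ Ψ (τ, p) v :=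
    fun τ hτ v => (hcf.comp_continuous (f := fun p : ℝ => (τ, p)) (by fun_prop)
      (hmem hτ)).clm_apply continuous_const
  have hzero : ∀ τ ∈ Ioo s T, ∀ p, R < |p| → fderiv ℝ Ψ (τ, p) = 0 := by
    intro τ hτ p hp
    have hnhds : {y : ℝ × ℝ | y.1 ∈ Ioo s T ∧ R < |y.2|} ∈ 𝓝 (τ, p) :=
      ((isOpen_Ioo.preimage continuous_fst).inter
        (isOpen_lt continuous_const continuous_snd.abs)).mem_nhds ⟨hτ, hp⟩
    have : Ψ =ᶠ[𝓝 (τ, p)] fun _ => 0 := by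
      filter_upwards [hnhds] with y hy using hR y.1 hy.1 y.2 hy.2
    rw [this.fderiv_eq]
    simp
  have hcs : ∀ {φ : ℝ → ℝ}, (∀ p, R < |p| → φ p = 0) → HasCompactSupport φ := by
    intro φ hφ
    refine HasCompactSupport.intro (isCompact_Icc (a := -R) (b := R)) fun p hp => hφ p ?_
    by_contra! h
    exact hp (abs_le.1 h)
  have hint : ∀ τ ∈ Ioo s T, Integrable fun p => Ψ (τ, p) := fun τ hτ =>
    (hcont τ hτ).integrable_of_hasCompactSupport (hcs (hR τ hτ))
  have hintD : ∀ v : ℝ × ℝ, Integrable fun p => fderiv ℝ Ψ (t, p) v := fun v =>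
    (hcontD t ht v).integrable_of_hasCompactSupport
      (hcs fun p hp => by rw [hzero t ht p hp]; rfl)
  have hflux : ∫ p, fderiv ℝ Ψ (t, p) (0, 1) = 0 := by
    refine integral_eq_zero_of_hasDerivAt_of_integrable (f := fun p => Ψ (t, p)) (fun p => ?_)
      (hintD _) (hint t ht)
    exact (hdiff ht p).comp_hasDerivAt p ((hasDerivAt_const p t).prodMk (hasDerivAt_id p))
  have hsplit : ∀ p, fderiv ℝ Ψ (t, p) (1, b)
      = fderiv ℝ Ψ (t, p) (1, 0) + b * fderiv ℝ Ψ (t, p) (0, 1) := by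
    intro p
    rw [← smul_eq_mul, ← map_smul, ← map_add]
    simp
  -- A closed interval around `t` inside the domain makes the relevant part of the support compact,
  -- which provides the constant dominating the time derivative.
  obtain ⟨δ, hδ, hball⟩ : ∃ δ > 0, Icc (t - δ) (t + δ) ⊆ Ioo s T := by
    have h1 : 0 < min (t - s) (T - t) := lt_min (sub_pos.2 ht.1) (sub_pos.2 ht.2)
    have h2 := min_le_left (t - s) (T - t)
    have h3 := min_le_right (t - s) (T - t)
    exact ⟨min (t - s) (T - t) / 2, by linarith, fun τ hτ =>
      ⟨by linarith [hτ.1], by linarith [hτ.2]⟩⟩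
  obtain ⟨K, hK⟩ := ((isCompact_Icc (a := t - δ) (b := t + δ)).prod
    (isCompact_Icc (a := -R) (b := R))).exists_bound_of_continuousOn
      (f := fun y => fderiv ℝ Ψ y (1, 0))
      ((hcf.mono (prod_mono hball (subset_univ _))).clm_apply continuousOn_const)
  have hder : HasDerivAt (fun t => ∫ p, Ψ (t, p)) (∫ p, fderiv ℝ Ψ (t, p) (1, 0)) t := by
    refine (hasDerivAt_integral_of_dominated_loc_of_deriv_le (s := Icc (t - δ) (t + δ))
      (F := fun τ p => Ψ (τ, p)) (F' := fun τ p => fderiv ℝ Ψ (τ, p) (1, 0))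
      (bound := (Icc (-R) R).indicator fun _ => K)
      (Icc_mem_nhds (by linarith) (by linarith)) ?_ (hint t ht)
      (hintD _).aestronglyMeasurable ?_ ?_ ?_).2
    · filter_upwards [isOpen_Ioo.mem_nhds ht] with τ hτ using (hint τ hτ).aestronglyMeasurable
    · refine ae_of_all _ fun p τ hτ => ?_
      by_cases hp : p ∈ Icc (-R) R
      · rw [indicator_of_mem hp]
        exact hK (τ, p) ⟨hτ, hp⟩
      · rw [indicator_of_notMem hp, hzero τ (hball hτ) p (by
          by_contra! h
          exact hp (abs_le.1 h))]
        simp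
    · exact (integrable_indicator_iff measurableSet_Icc).2 (by simp)
    · refine ae_of_all _ fun p τ hτ => ?_
      exact (hdiff (hball hτ) p).comp_hasDerivAt τ
        ((hasDerivAt_id τ).prodMk (hasDerivAt_const τ p))
  refine ⟨hintD _, ?_⟩
  have : ∫ p, fderiv ℝ Ψ (t, p) (1, b) = ∫ p, fderiv ℝ Ψ (t, p) (1, 0) := by
    simp only [hsplit]
    rw [integral_add (hintD _) ((hintD _).const_mul b), integral_const_mul, hflux]
    ring
  rwa [this]

/-- A `C¹` solution of a diagonal transport system with speeds `α` and right hand side `N`. -/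
structure IsTransportSolution (α : ℝ → Fin 5 → ℝ) (N : ℝ → ℝ → Fin 5 → ℝ) (T : ℝ)
    (v : ℝ → ℝ → Fin 5 → ℝ) : Prop where
  smooth : ∀ i, ContDiffOn ℝ 1 (fun y : ℝ × ℝ => v y.1 y.2 i) (Ioc 0 T ×ˢ univ)
  equation : ∀ t ∈ Ioo 0 T, ∀ p i,
    fderiv ℝ (fun y : ℝ × ℝ => v y.1 y.2 i) (t, p) (1, α t i) = N t p i

variable {α : ℝ → Fin 5 → ℝ} {N : ℝ → ℝ → Fin 5 → ℝ} {v : ℝ → ℝ → Fin 5 → ℝ}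

theorem IsTransportSolution.continuousOn_energy (hv : IsTransportSolution α N T v)
    {W : Fin 5 → ℝ × ℝ → ℝ} (hW : ∀ i, ContinuousOn (W i) (Ioi 0 ×ˢ univ)) (hs : 0 < s)
    (hR : ∀ t ∈ Icc s T, ∀ p, R < |p| → ∀ i, W i (t, p) * v t p i ^ 2 = 0) :
    ContinuousOn (fun t => ∫ p, ∑ i, W i (t, p) * v t p i ^ 2) (Icc s T) := by
  refine continuousOn_integral_of_compact_support (isCompact_Icc (a := -R) (b := R)) ?_ ?_
  · refine continuousOn_finsetSum _ fun i _ => ?_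
    refine ((hW i).mono ?_).mul (((hv.smooth i).continuousOn.mono ?_).pow 2)
    · exact prod_mono (fun t ht => hs.trans_le ht.1) le_rfl
    · exact prod_mono (fun t ht => ⟨hs.trans_le ht.1, ht.2⟩) le_rfl
  · intro t p ht hp
    refine Finset.sum_eq_zero fun i _ => hR t ht p ?_ i
    by_contra! h
    exact hp (abs_le.1 h)

/-- The energy inequality: a pointwise lower bound of the density of the time derivative, with the
spatial transport terms removed, bounds the derivative of the energy from below. -/
theorem IsTransportSolution.exists_hasDerivAt_energy (hv : IsTransportSolution α N T v)
    {W : Fin 5 → ℝ × ℝ → ℝ} (hW : ∀ i, ContDiffOn ℝ 1 (W i) (Ioi 0 ×ˢ univ)) (hs : 0 < s)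
    (hR : ∀ t ∈ Icc s T, ∀ p, R < |p| → ∀ i, W i (t, p) * v t p i ^ 2 = 0)
    {γ : ℝ → ℝ} (hγ : Integrable γ) {t : ℝ} (ht : t ∈ Ioo s T) {K k : ℝ}
    (hbound : ∀ p, -K * ∑ i, W i (t, p) * v t p i ^ 2 - k * γ p ≤
      ∑ i, (fderiv ℝ (W i) (t, p) (1, α t i) * v t p i ^ 2
        + 2 * W i (t, p) * v t p i * N t p i)) :
    ∃ F', HasDerivAt (fun t => ∫ p, ∑ i, W i (t, p) * v t p i ^ 2) F' t ∧
      -K * (∫ p, ∑ i, W i (t, p) * v t p i ^ 2) - k * ∫ p, γ p ≤ F' := by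
  have hsub : Ioo s T ×ˢ (univ : Set ℝ) ⊆ Ioi 0 ×ˢ univ :=
    prod_mono (fun t ht => hs.trans ht.1) le_rfl
  have hsub' : Ioo s T ×ˢ (univ : Set ℝ) ⊆ Ioc 0 T ×ˢ univ :=
    prod_mono (fun t ht => ⟨hs.trans ht.1, ht.2.le⟩) le_rfl
  have hopen : IsOpen (Ioo s T ×ˢ (univ : Set ℝ)) := isOpen_Ioo.prod isOpen_univ
  have hΨ : ∀ i, ContDiffOn ℝ 1 (fun y : ℝ × ℝ => W i y * v y.1 y.2 i ^ 2) (Ioo s T ×ˢ univ) :=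
    fun i => ((hW i).mono hsub).mul (((hv.smooth i).mono hsub').pow 2)
  -- Each component is differentiated along its own velocity, frozen at time `t`. The equation then
  -- replaces the derivative by `N`, and no bound on the speed is needed.
  have key := fun i => hasDerivAt_integral_transport (hΨ i)
    (fun τ hτ p hp => hR τ ⟨hτ.1.le, hτ.2.le⟩ p hp i) (α t i) ht
  have hint : ∀ τ ∈ Ioo s T, ∀ i, Integrable fun p => W i (τ, p) * v τ p i ^ 2 := by
    intro τ hτ i
    refine Continuous.integrable_of_hasCompactSupport
      ((hΨ i).continuousOn.comp_continuous (f := fun p : ℝ => (τ, p)) (by fun_prop)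
        fun p => ⟨hτ, mem_univ p⟩) ?_
    refine HasCompactSupport.intro (isCompact_Icc (a := -R) (b := R)) fun p hp =>
      hR τ ⟨hτ.1.le, hτ.2.le⟩ p ?_ i
    by_contra! h
    exact hp (abs_le.1 h)
  have hpt : ∀ p i, fderiv ℝ (fun y : ℝ × ℝ => W i y * v y.1 y.2 i ^ 2) (t, p) (1, α t i)
      = fderiv ℝ (W i) (t, p) (1, α t i) * v t p i ^ 2 + 2 * W i (t, p) * v t p i * N t p i := by
    intro p i
    have h1 : HasFDerivAt (W i) (fderiv ℝ (W i) (t, p)) (t, p) :=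
      ((((hW i).mono hsub).contDiffAt (hopen.mem_nhds ⟨ht, mem_univ p⟩)).differentiableAt
        one_ne_zero).hasFDerivAt
    have h2 : HasFDerivAt (fun y : ℝ × ℝ => v y.1 y.2 i)
        (fderiv ℝ (fun y : ℝ × ℝ => v y.1 y.2 i) (t, p)) (t, p) :=
      ((((hv.smooth i).mono hsub').contDiffAt (hopen.mem_nhds ⟨ht, mem_univ p⟩)).differentiableAt
        one_ne_zero).hasFDerivAt
    have h3 : HasFDerivAt (fun y : ℝ × ℝ => v y.1 y.2 i ^ 2)
        ((2 * v t p i) • fderiv ℝ (fun y : ℝ × ℝ => v y.1 y.2 i) (t, p)) (t, p) := by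
      simpa using h2.pow 2
    rw [(h1.fun_mul h3).fderiv, ← hv.equation t ⟨hs.trans ht.1, ht.2⟩ p i]
    simp
    ring
  refine ⟨∑ i, ∫ p, fderiv ℝ (fun y : ℝ × ℝ => W i y * v y.1 y.2 i ^ 2) (t, p) (1, α t i), ?_, ?_⟩
  · refine (HasDerivAt.fun_sum fun i (_ : i ∈ Finset.univ) => (key i).2).congr_of_eventuallyEq ?_
    filter_upwards [isOpen_Ioo.mem_nhds ht] with τ hτ
    exact integral_finsetSum _ fun i _ => hint τ hτ i
  · rw [← integral_finsetSum _ fun i _ => (key i).1, ← integral_const_mul, ← integral_const_mul,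
      ← integral_sub ((integrable_finsetSum _ fun i _ => hint t ht i).const_mul _)
        (hγ.const_mul _)]
    refine integral_mono (((integrable_finsetSum _ fun i _ => hint t ht i).const_mul _).sub
        (hγ.const_mul _)) (integrable_finsetSum _ fun i _ => (key i).1) fun p => ?_
    simp only [hpt]
    exact hbound p

/-- Growth bound from a differential inequality, backwards in time. -/
theorem le_of_deriv_ge {F : ℝ → ℝ} {K k : ℝ} (hF : ContinuousOn F (Icc s T))
    (hF' : ∀ t ∈ Ioo s T, ∃ F', HasDerivAt F F' t ∧ -K * F t - K * k ≤ F') (hsT : s ≤ T) :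
    F s + k ≤ (F T + k) * Real.exp (K * (T - s)) := by
  have hmono : MonotoneOn (fun t => (F t + k) * Real.exp (K * t)) (Icc s T) := by
    refine monotoneOn_of_deriv_nonneg (convex_Icc s T) ?_ ?_ ?_
    · exact (hF.add continuousOn_const).mul (by fun_prop)
    · rw [interior_Icc]
      intro t ht
      obtain ⟨F', h, -⟩ := hF' t ht
      exact ((h.add_const k).mul
        ((hasDerivAt_id' t).const_mul K).exp).differentiableAt.differentiableWithinAt
    · rw [interior_Icc]
      intro t ht
      obtain ⟨F', h, hle⟩ := hF' t ht
      rw [((h.add_const k).fun_mul ((hasDerivAt_id' t).const_mul K).exp).deriv]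
      have := Real.exp_pos (K * t)
      nlinarith
  have h := hmono ⟨le_rfl, hsT⟩ ⟨hsT, le_rfl⟩ hsT
  simp only at h
  rw [mul_sub, Real.exp_sub, mul_div_assoc', le_div_iff₀ (Real.exp_pos _)]
  exact h

/-- Linear growth bound from a differential inequality, backwards in time. -/
theorem le_add_of_deriv_ge {F : ℝ → ℝ} {k : ℝ} (hF : ContinuousOn F (Icc s T))
    (hF' : ∀ t ∈ Ioo s T, ∃ F', HasDerivAt F F' t ∧ -k ≤ F') (hsT : s ≤ T) :
    F s ≤ F T + k * (T - s) := by
  have hmono : MonotoneOn (fun t => F t + k * t) (Icc s T) := by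
    refine monotoneOn_of_deriv_nonneg (convex_Icc s T) (hF.add (by fun_prop)) ?_ ?_
    · rw [interior_Icc]
      intro t ht
      obtain ⟨F', h, -⟩ := hF' t ht
      exact (h.add ((hasDerivAt_id' t).const_mul k)).differentiableAt.differentiableWithinAt
    · rw [interior_Icc]
      intro t ht
      obtain ⟨F', h, hle⟩ := hF' t ht
      rw [HasDerivAt.deriv (h.fun_add ((hasDerivAt_id' t).const_mul k))]
      linarith
  have h := hmono ⟨le_rfl, hsT⟩ ⟨hsT, le_rfl⟩ hsT
  simp only at h
  linarith

end EnergyCalculus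

/-! ### The background near the Cauchy horizon and the size of the coefficients -/

section Background

variable {a z zc c : ℝ}

/-- The open set on which the background is smooth. -/
def regularSet (a : ℝ) : Set ℝ := {z | 0 < 1 + a * z}

theorem isOpen_regularSet : IsOpen (regularSet a) := isOpen_lt continuous_const (by fun_prop)

theorem S_pos (hz : z ∈ regularSet a) : 0 < S a z := Real.rpow_pos_of_pos hz _

theorem contDiffOn_S : ContDiffOn ℝ ∞ (S a) (regularSet a) := by
  intro z hz
  refine ContDiffAt.contDiffWithinAt ?_
  exact ContDiffAt.rpow_const_of_ne (by fun_prop) (ne_of_gt hz)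

theorem contDiffOn_iteratedDeriv_S (n : ℕ) :
    ContDiffOn ℝ ∞ (iteratedDeriv n (S a)) (regularSet a) := by
  induction n with
  | zero => simpa using contDiffOn_S
  | succ n ih =>
    rw [iteratedDeriv_succ]
    exact ih.deriv_of_isOpen isOpen_regularSet le_rfl

theorem hasDerivAt_S (hz : z ∈ regularSet a) :
    HasDerivAt (S a) (2 / 3 * a * (1 + a * z) ^ (-(1 / 3) : ℝ)) z := by
  have h : HasDerivAt (fun z => 1 + a * z) a z := by
    simpa using ((hasDerivAt_id z).const_mul a).const_add 1
  have h' := h.rpow_const (p := 2 / 3) (Or.inl (ne_of_gt hz))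
  rw [show (2 / 3 - 1 : ℝ) = -(1 / 3) by norm_num, mul_comm a] at h'
  exact h'

theorem deriv_S_pos (ha : 0 < a) (hz : z ∈ regularSet a) : 0 < deriv (S a) z := by
  rw [(hasDerivAt_S hz).deriv]
  have : 0 < (1 + a * z) ^ (-(1 / 3) : ℝ) := Real.rpow_pos_of_pos hz _
  positivity

theorem deriv_S_antitone (ha : 0 < a) {y : ℝ} (hz : z ∈ regularSet a) (hzy : z ≤ y) :
    deriv (S a) y ≤ deriv (S a) z := by
  have hz' : 0 < 1 + a * z := hz
  have hy : 1 + a * z ≤ 1 + a * y := by nlinarith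
  rw [(hasDerivAt_S hz).deriv, (hasDerivAt_S (hz'.trans_le hy : y ∈ regularSet a)).deriv]
  exact mul_le_mul_of_nonneg_left (Real.rpow_le_rpow_of_nonpos hz' hy (by norm_num)) (by positivity)

theorem q_denominator_pos (hz : z ∈ regularSet a) :
    0 < 3 + 4 * a * z + a ^ 2 * z ^ 2 := by
  have hz' : 0 < 1 + a * z := hz
  nlinarith

theorem q_pos (ha : 0 < a) (hz : z ∈ regularSet a) : 0 < q a z := by
  have := q_denominator_pos hz
  unfold q
  positivity

theorem contDiffOn_q : ContDiffOn ℝ ∞ (q a) (regularSet a) := by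
  refine ContDiffOn.div (by fun_prop) (by fun_prop) fun z hz => ?_
  have := q_denominator_pos hz
  positivity

/-- The function whose zero is the Cauchy horizon. -/
noncomputable def hPlus (a z : ℝ) : ℝ := z + S a z - z * deriv (S a) z

theorem contDiffOn_hPlus : ContDiffOn ℝ ∞ (hPlus a) (regularSet a) := by
  have h := contDiffOn_iteratedDeriv_S (a := a) 1
  rw [iteratedDeriv_one] at h
  exact (contDiffOn_id.add contDiffOn_S).sub (contDiffOn_id.mul h)

theorem hasDerivAt_hPlus (hz : z ∈ regularSet a) :
    HasDerivAt (hPlus a) (1 - z * iteratedDeriv 2 (S a) z) z := by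
  have hd : ∀ n, HasDerivAt (iteratedDeriv n (S a)) (iteratedDeriv (n + 1) (S a) z) z := by
    intro n
    rw [iteratedDeriv_succ]
    exact (((contDiffOn_iteratedDeriv_S n).contDiffAt
      (isOpen_regularSet.mem_nhds hz)).differentiableAt (by simp)).hasDerivAt
  have h0 := hd 0
  have h1 := hd 1
  simp only [zero_add, iteratedDeriv_zero, iteratedDeriv_one] at h0 h1
  exact (((hasDerivAt_id' z).fun_add h0).fun_sub ((hasDerivAt_id' z).fun_mul h1)).congr_deriv
    (by ring)

variable (ha : 0 < a) (hzc : IsCauchyHorizon a zc)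
include ha hzc

theorem IsCauchyHorizon.mem_regularSet (hz : zc ≤ z) : z ∈ regularSet a := by
  have h1 := hzc.1.1
  rw [div_lt_iff₀ ha] at h1
  show 0 < 1 + a * z
  nlinarith

omit ha in
theorem IsCauchyHorizon.neg : zc < 0 := hzc.1.2.1

omit ha in
theorem IsCauchyHorizon.hPlus_eq_zero : hPlus a zc = 0 := hzc.1.2.2

/-- At the horizon `S = z(S' - 1)` with `S > 0` and `z < 0`, which forces `S' < 1`; to the right of
it `S'` only decreases. This keeps the denominators `S' - 1` away from zero. -/
theorem IsCauchyHorizon.deriv_S_lt_one (hz : zc ≤ z) : deriv (S a) z < 1 := by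
  have hmem := hzc.mem_regularSet ha le_rfl
  refine (deriv_S_antitone ha hmem hz).trans_lt ?_
  have h := hzc.hPlus_eq_zero
  have := S_pos hmem
  have := hzc.neg
  unfold hPlus at h
  nlinarith

/-- Since `hPlus` equals 1 at `z = 0`, a nonpositive value would produce a root to the right of
`zc`, against maximality. -/
theorem IsCauchyHorizon.hPlus_pos (hz : zc < z) (hz0 : z < 0) : 0 < hPlus a z := by
  by_contra! h
  have hcont : ContinuousOn (hPlus a) (Icc z 0) := contDiffOn_hPlus.continuousOn.mono
    fun y hy => hzc.mem_regularSet ha (hz.le.trans hy.1)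
  have h0 : hPlus a 0 = 1 := by simp [hPlus, S]
  obtain ⟨y, hy, hy0⟩ := intermediate_value_Icc hz0.le hcont
    (show (0 : ℝ) ∈ Icc (hPlus a z) (hPlus a 0) from ⟨h, by simp [h0]⟩)
  have hyne : y ≠ 0 := by
    rintro rfl
    linarith
  have : y ≤ zc := hzc.2 ⟨hzc.1.1.trans (hz.trans_le hy.1), lt_of_le_of_ne hy.2 hyne, hy0⟩
  linarith [hy.1]

theorem IsCauchyHorizon.w_pos (hz : zc ≤ z) (hz0 : z ≤ 0) : 0 < S a z - z * deriv (S a) z := by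
  have hmem := hzc.mem_regularSet ha hz
  have := S_pos hmem
  have := deriv_S_pos ha hmem
  nlinarith

omit ha hzc

/-- The product of the fifth row of the coefficient matrix with `z + S - z S'`. -/
noncomputable def fifthRow (a z : ℝ) : Fin 5 → ℝ :=
  let D := deriv (S a) z
  let E := iteratedDeriv 2 (S a) z
  let S := S a z
  ![-(4 * (-z * D ^ 2 + S * (D + z * E)) / S), 0, -((-1 + D) * (S - z * D) / S),
    -((-1 + D) * (S - z * D) / S), -((3 + (-z + S) * E + D * (-3 + z * E)) / (-1 + D))]

theorem Ctilde_four (l : ℕ) (j : Fin 5) : Ctilde a l z 4 j = fifthRow a z j / hPlus a z := by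
  fin_cases j <;> simp [Ctilde, fifthRow, hPlus, div_mul_eq_div_div, neg_div]

theorem sourceTilde_four : sourceTilde a z 4
    = 8 * Real.pi * q a z * (-1 + deriv (S a) z) * (S a z - z * deriv (S a) z) / S a z
      / hPlus a z := by
  simp [sourceTilde, hPlus, div_mul_eq_div_div]

include ha hzc

/-- The first four rows involve the denominators `z`, `S`, `S' ± 1`, `w`, `h_-` and `q` only, and
none of these vanishes on `[zc, 0)`. Multiplying by `t` therefore makes these rows `O(t)`. -/
theorem IsCauchyHorizon.continuousAt_Ctilde (l : ℕ) {i : Fin 5} (hi : i ≠ 4) (j : Fin 5)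
    (hz : zc ≤ z) (hz0 : z < 0) : ContinuousAt (fun z => Ctilde a l z i j) z := by
  have hmem := hzc.mem_regularSet ha hz
  have hnhds := isOpen_regularSet.mem_nhds hmem
  have cS : ContinuousAt (S a) z := contDiffOn_S.continuousOn.continuousAt hnhds
  have cI := fun n => (contDiffOn_iteratedDeriv_S (a := a) n).continuousOn.continuousAt hnhds
  have cD : ContinuousAt (deriv (S a)) z := by simpa using cI 1
  have cE := cI 2
  have cF := cI 3
  have cq : ContinuousAt (q a) z := contDiffOn_q.continuousOn.continuousAt hnhds
  have cr : ContinuousAt (deriv (q a)) z :=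
    (contDiffOn_q.deriv_of_isOpen (m := ∞) isOpen_regularSet
      le_rfl).continuousOn.continuousAt hnhds
  have nS := (S_pos hmem).ne'
  have nq := (q_pos ha hmem).ne'
  have nz := hz0.ne
  have nw := (hzc.w_pos ha hz hz0.le).ne'
  have n1 : -1 + deriv (S a) z ≠ 0 := by linarith [hzc.deriv_S_lt_one ha hz]
  have n2 : 1 + deriv (S a) z ≠ 0 := by linarith [deriv_S_pos ha hmem]
  have n3 : z - S a z + z * deriv (S a) z ≠ 0 := by
    have := hzc.w_pos ha hz hz0.le
    linarith
  clear cI hnhds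
  fin_cases i <;> fin_cases j <;> simp [Ctilde] at hi ⊢ <;>
    fun_prop (disch := first | assumption | simp_all)

theorem IsCauchyHorizon.continuousAt_sourceTilde {i : Fin 5} (hi : i ≠ 4)
    (hz : zc ≤ z) (hz0 : z < 0) : ContinuousAt (fun z => sourceTilde a z i) z := by
  have hmem := hzc.mem_regularSet ha hz
  have hnhds := isOpen_regularSet.mem_nhds hmem
  have cS : ContinuousAt (S a) z := contDiffOn_S.continuousOn.continuousAt hnhds
  have cD : ContinuousAt (deriv (S a)) z := by
    simpa using (contDiffOn_iteratedDeriv_S (a := a) 1).continuousOn.continuousAt hnhds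
  have cq : ContinuousAt (q a) z := contDiffOn_q.continuousOn.continuousAt hnhds
  have nS := (S_pos hmem).ne'
  have nz := hz0.ne
  have n3 : z - S a z + z * deriv (S a) z ≠ 0 := by
    have := hzc.w_pos ha hz hz0.le
    linarith
  clear hnhds
  fin_cases i <;> simp [sourceTilde] at hi ⊢ <;>
    fun_prop (disch := first | assumption | simp_all)

theorem IsCauchyHorizon.continuousAt_fifthRow (j : Fin 5)
    (hz : zc ≤ z) : ContinuousAt (fun z => fifthRow a z j) z := by
  have hmem := hzc.mem_regularSet ha hz
  have hnhds := isOpen_regularSet.mem_nhds hmem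
  have cS : ContinuousAt (S a) z := contDiffOn_S.continuousOn.continuousAt hnhds
  have cI := fun n => (contDiffOn_iteratedDeriv_S (a := a) n).continuousOn.continuousAt hnhds
  have cD : ContinuousAt (deriv (S a)) z := by simpa using cI 1
  have cE := cI 2
  have nS := (S_pos hmem).ne'
  have n1 : -1 + deriv (S a) z ≠ 0 := by linarith [hzc.deriv_S_lt_one ha hz]
  clear cI hnhds
  fin_cases j <;> simp [fifthRow] <;>
    fun_prop (disch := first | assumption | simp_all)

theorem IsCauchyHorizon.continuousAt_fifthSource (hz : zc ≤ z) :
    ContinuousAt (fun z => 8 * Real.pi * q a z * (-1 + deriv (S a) z)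
      * (S a z - z * deriv (S a) z) / S a z) z := by
  have hmem := hzc.mem_regularSet ha hz
  have hnhds := isOpen_regularSet.mem_nhds hmem
  have cS : ContinuousAt (S a) z := contDiffOn_S.continuousOn.continuousAt hnhds
  have cD : ContinuousAt (deriv (S a)) z := by
    simpa using (contDiffOn_iteratedDeriv_S (a := a) 1).continuousOn.continuousAt hnhds
  have cq : ContinuousAt (q a) z := contDiffOn_q.continuousOn.continuousAt hnhds
  have nS := (S_pos hmem).ne'
  fun_prop (disch := assumption)

/-- Substituting `S = z S' - z` cancels the denominator. With `d = 1 - z S''`, the derivative of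
`hPlus`, the value is `1 + 2d`, which ties the exponent to `d`. -/
theorem IsCauchyHorizon.fifthRow_four :
    fifthRow a zc 4 = 3 - 2 * (zc * iteratedDeriv 2 (S a) zc) := by
  have h := hzc.hPlus_eq_zero
  have n1 : -1 + deriv (S a) zc ≠ 0 := by linarith [hzc.deriv_S_lt_one ha le_rfl]
  have hS : S a zc = zc * deriv (S a) zc - zc := by
    unfold hPlus at h
    linarith
  simp only [fifthRow, Matrix.cons_val]
  rw [hS]
  field_simp
  ring

/-- The exponent is `2` plus the limit of `t / h₊`. -/
theorem IsCauchyHorizon.tendsto_div_hPlus {l : ℕ} (hc : IsExponent a l zc c) :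
    2 ≤ c ∧ Tendsto (fun t => t / hPlus a (zc + t)) (𝓝[>] 0) (𝓝 (c - 2)) := by
  set d := 1 - zc * iteratedDeriv 2 (S a) zc with hd
  have hmem := hzc.mem_regularSet ha le_rfl
  have hslope : Tendsto (fun t => hPlus a (zc + t) / t) (𝓝[>] 0) (𝓝 d) := by
    have h := (hasDerivAt_iff_tendsto_slope_zero.1 (hasDerivAt_hPlus hmem)).mono_left
      (nhdsWithin_mono _ fun t (ht : 0 < t) => ht.ne')
    refine h.congr fun t => ?_
    rw [hzc.hPlus_eq_zero, smul_eq_mul, sub_zero]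
    ring
  have hev : ∀ᶠ t in 𝓝[>] (0 : ℝ), 0 < t ∧ zc + t < 0 := by
    filter_upwards [Ioo_mem_nhdsGT (neg_pos.2 hzc.neg)] with t ht
    exact ⟨ht.1, by linarith [ht.2]⟩
  have hd0 : 0 ≤ d := by
    refine ge_of_tendsto hslope ?_
    filter_upwards [hev] with t ht
    exact (div_pos (hzc.hPlus_pos ha (by linarith [ht.1]) ht.2) ht.1).le
  have hn : fifthRow a zc 4 = 1 + 2 * d := by
    rw [hzc.fifthRow_four ha, hd]
    ring
  have hadd : Tendsto (fun t : ℝ => zc + t) (𝓝[>] 0) (𝓝 zc) := by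
    have : Tendsto (fun t : ℝ => zc + t) (𝓝 0) (𝓝 (zc + 0)) := by
      exact (continuous_const.add continuous_id).tendsto 0
    rw [add_zero] at this
    exact this.mono_left nhdsWithin_le_nhds
  have hrow : Tendsto (fun t => fifthRow a (zc + t) 4) (𝓝[>] 0) (𝓝 (1 + 2 * d)) := by
    rw [← hn]
    exact (hzc.continuousAt_fifthRow ha 4 le_rfl).tendsto.comp hadd
  -- The convergence of `C_55` is used here as a hypothesis on `t / hPlus`: dividing by the nonzero
  -- limit `1 + 2d` of the numerator gives a finite limit without knowing yet that `d` is nonzero.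
  have hκ : Tendsto (fun t => t / hPlus a (zc + t)) (𝓝[>] 0) (𝓝 (c / (1 + 2 * d))) := by
    refine (Tendsto.div hc hrow (by positivity)).congr' ?_
    filter_upwards [hrow.eventually_ne (by positivity : (1 + 2 * d) ≠ 0)] with t ht
    simp only [C, Matrix.smul_apply, smul_eq_mul, Ctilde_four, Pi.div_apply]
    field_simp
  -- The two quotients are reciprocal, so the product of their limits is 1. This excludes `d = 0`
  -- and yields `c = 2 + 1/d`.
  have hone : c / (1 + 2 * d) * d = 1 := by
    refine tendsto_nhds_unique ((hκ.mul hslope).congr' ?_) tendsto_const_nhds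
    filter_upwards [hev] with t ht
    have := hzc.hPlus_pos ha (by linarith [ht.1]) ht.2
    have := ht.1
    field_simp
  have hκ0 : 0 ≤ c / (1 + 2 * d) := by
    by_contra! h
    nlinarith
  have hkc : c / (1 + 2 * d) = c - 2 := by
    have h1 : (1 + 2 * d) ≠ 0 := by positivity
    have h2 : c * d = 1 + 2 * d := by
      field_simp at hone
      exact hone
    rw [div_eq_iff h1]
    nlinarith
  rw [hkc] at hκ hκ0
  exact ⟨by linarith, hκ⟩

omit ha hzc in
theorem exists_abs_le_of_continuousAt {f : ℝ → ℝ} {T : ℝ}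
    (hf : ∀ z, zc ≤ z → z < 0 → ContinuousAt f z) (hT : zc + T < 0) :
    ∃ M, ∀ t ∈ Ioc 0 T, |f (zc + t)| ≤ M := by
  obtain ⟨M, hM⟩ := (isCompact_Icc (a := zc) (b := zc + T)).exists_bound_of_continuousOn (f := f)
    fun z hz => (hf z hz.1 (hz.2.trans_lt hT)).continuousWithinAt
  exact ⟨M, fun t ht => hM _ ⟨by linarith [ht.1], by linarith [ht.2]⟩⟩

/-- Near 0 the quotient is controlled by its limit, and on the remaining compact interval by
continuity. -/
theorem IsCauchyHorizon.exists_div_hPlus_le {l : ℕ} (hc : IsExponent a l zc c) {T : ℝ}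
    (hT : zc + T < 0) : ∃ M, ∀ t ∈ Ioc 0 T, |t / hPlus a (zc + t)| ≤ M := by
  have h := (hzc.tendsto_div_hPlus ha hc).2.abs.eventually_le_const (lt_add_one |c - 2|)
  obtain ⟨δ, hδ, hδM⟩ := mem_nhdsGT_iff_exists_Ioc_subset.1 h
  have hδ : 0 < δ := hδ
  obtain ⟨M, hM⟩ := (isCompact_Icc (a := δ) (b := T)).exists_bound_of_continuousOn
    (f := fun t => t / hPlus a (zc + t)) (by
      refine continuousOn_id.div ?_ ?_
      · refine contDiffOn_hPlus.continuousOn.comp (by fun_prop) fun t ht => ?_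
        exact hzc.mem_regularSet ha (by linarith [ht.1])
      · intro t ht
        exact (hzc.hPlus_pos ha (by linarith [ht.1]) (by linarith [ht.2])).ne')
  refine ⟨max (|c - 2| + 1) M, fun t ht => ?_⟩
  rcases le_total t δ with h | h
  · exact le_max_of_le_left (hδM ⟨ht.1, h⟩)
  · exact le_max_of_le_right (hM t ⟨h, ht.2⟩)

/-- The structure of the coefficients: the first four rows vanish to first order at the horizon, and
the fifth row is bounded. -/
theorem IsCauchyHorizon.exists_coefficient_bound {l : ℕ} (hc : IsExponent a l zc c) {T : ℝ}
    (hT : zc + T < 0) : ∃ M > 0, ∀ t ∈ Ioc 0 T,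
      (∀ i j, i ≠ 4 → |C a l zc t i j| ≤ M * t) ∧ (∀ j, |C a l zc t 4 j| ≤ M) ∧
      (∀ i, i ≠ 4 → |source a zc t i| ≤ M * t) ∧ |source a zc t 4| ≤ M := by
  have h1 : ∀ i j, ∃ M, ∀ t ∈ Ioc 0 T, i ≠ 4 → |C a l zc t i j| ≤ M * t := by
    intro i j
    by_cases hi : i = 4
    · exact ⟨0, fun t _ h => absurd hi h⟩
    obtain ⟨M, hM⟩ := exists_abs_le_of_continuousAt
      (fun z hz hz0 => hzc.continuousAt_Ctilde ha l hi j hz hz0) hT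
    refine ⟨M, fun t ht _ => ?_⟩
    rw [C, Matrix.smul_apply, smul_eq_mul, abs_mul, abs_of_pos ht.1, mul_comm]
    exact mul_le_mul_of_nonneg_right (hM t ht) ht.1.le
  obtain ⟨M₀, hM₀⟩ := hzc.exists_div_hPlus_le ha hc hT
  have h2 : ∀ j, ∃ M, ∀ t ∈ Ioc 0 T, |C a l zc t 4 j| ≤ M := by
    intro j
    obtain ⟨M, hM⟩ := exists_abs_le_of_continuousAt
      (fun z hz _ => hzc.continuousAt_fifthRow ha j hz) hT
    refine ⟨M₀ * M, fun t ht => ?_⟩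
    rw [C, Matrix.smul_apply, smul_eq_mul, Ctilde_four, mul_div_left_comm, mul_comm, abs_mul]
    exact mul_le_mul (hM₀ t ht) (hM t ht) (abs_nonneg _) ((abs_nonneg _).trans (hM₀ t ht))
  have h3 : ∀ i, ∃ M, ∀ t ∈ Ioc 0 T, i ≠ 4 → |source a zc t i| ≤ M * t := by
    intro i
    by_cases hi : i = 4
    · exact ⟨0, fun t _ h => absurd hi h⟩
    obtain ⟨M, hM⟩ := exists_abs_le_of_continuousAt
      (fun z hz hz0 => hzc.continuousAt_sourceTilde ha hi hz hz0) hT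
    refine ⟨M, fun t ht _ => ?_⟩
    rw [source, Pi.smul_apply, smul_eq_mul, abs_mul, abs_of_pos ht.1, mul_comm]
    exact mul_le_mul_of_nonneg_right (hM t ht) ht.1.le
  obtain ⟨M₃, hM₃⟩ : ∃ M, ∀ t ∈ Ioc 0 T, |source a zc t 4| ≤ M := by
    obtain ⟨M, hM⟩ := exists_abs_le_of_continuousAt
      (fun z hz _ => hzc.continuousAt_fifthSource ha hz) hT
    refine ⟨M₀ * M, fun t ht => ?_⟩
    rw [source, Pi.smul_apply, smul_eq_mul, sourceTilde_four, mul_div_left_comm, mul_comm, abs_mul]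
    exact mul_le_mul (hM₀ t ht) (hM t ht) (abs_nonneg _) ((abs_nonneg _).trans (hM₀ t ht))
  choose M₁ hM₁ using h1
  choose M₂ hM₂ using h2
  choose M₄ hM₄ using h3
  obtain ⟨M, hM⟩ := Finite.bddAbove_range
    (Sum.elim (fun ij : Fin 5 × Fin 5 => M₁ ij.1 ij.2) (Sum.elim M₂ M₄))
  have b1 : ∀ i j, M₁ i j ≤ M := fun i j => hM ⟨Sum.inl (i, j), rfl⟩
  have b2 : ∀ j, M₂ j ≤ M := fun j => hM ⟨Sum.inr (Sum.inl j), rfl⟩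
  have b4 : ∀ i, M₄ i ≤ M := fun j => hM ⟨Sum.inr (Sum.inr j), rfl⟩
  have hM' : M ≤ max (max M M₃) 1 := (le_max_left _ _).trans (le_max_left _ _)
  refine ⟨max (max M M₃) 1, by positivity,
    fun t ht => ⟨fun i j hi => ?_, fun j => ?_, fun i hi => ?_, ?_⟩⟩
  · exact (hM₁ i j t ht hi).trans (mul_le_mul_of_nonneg_right ((b1 i j).trans hM') ht.1.le)
  · exact (hM₂ j t ht).trans ((b2 j).trans hM')
  · exact (hM₄ i t ht hi).trans (mul_le_mul_of_nonneg_right ((b4 i).trans hM') ht.1.le)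
  · exact (hM₃ t ht).trans ((le_max_right _ _).trans (le_max_left _ _))

/-- The lower end `s > 0` is essential, because the last speed is `-1/h_+`. The bound serves finite
propagation only, not the energy estimates. -/
theorem IsCauchyHorizon.exists_speed_bound {s T : ℝ} (hs : 0 < s) (hT : zc + T < 0) :
    ∃ M > 0, ∀ t ∈ Icc s T, ∀ i, |Atilde a (zc + t) i i| ≤ M := by
  have h : ∀ i, ∃ M, ∀ t ∈ Icc s T, |Atilde a (zc + t) i i| ≤ M := by
    intro i
    have hcont : ContinuousOn (fun z => Atilde a z i i) (Icc (zc + s) (zc + T)) := by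
      intro z hz
      have hz1 : zc < z := by linarith [hz.1]
      have hz0 : z < 0 := by linarith [hz.2]
      have hmem := hzc.mem_regularSet ha hz1.le
      have hnhds := isOpen_regularSet.mem_nhds hmem
      have cS : ContinuousAt (S a) z := contDiffOn_S.continuousOn.continuousAt hnhds
      have cD : ContinuousAt (deriv (S a)) z := by
        simpa using (contDiffOn_iteratedDeriv_S (a := a) 1).continuousOn.continuousAt hnhds
      have nz := hz0.ne
      have n3 : z - S a z + z * deriv (S a) z ≠ 0 := by
        have := hzc.w_pos ha hz1.le hz0.le
        linarith
      have n4 : z + S a z - z * deriv (S a) z ≠ 0 := (hzc.hPlus_pos ha hz1 hz0).ne'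
      clear hnhds
      refine ContinuousAt.continuousWithinAt ?_
      fin_cases i <;> simp [Atilde] <;>
        fun_prop (disch := first | assumption | simp_all)
    obtain ⟨M, hM⟩ := isCompact_Icc.exists_bound_of_continuousOn hcont
    exact ⟨M, fun t ht => hM _ ⟨by linarith [ht.1], by linarith [ht.2]⟩⟩
  choose M hM using h
  obtain ⟨B, hB⟩ := Finite.bddAbove_range M
  refine ⟨max B 1, by positivity, fun t ht i => ?_⟩
  exact (hM i t ht).trans ((hB ⟨i, rfl⟩).trans (le_max_left _ _))

end Background

/-! ### Finite speed of propagation -/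

section Propagation

variable {s T R : ℝ} {α : ℝ → Fin 5 → ℝ} {N : ℝ → ℝ → Fin 5 → ℝ} {v : ℝ → ℝ → Fin 5 → ℝ}

theorem IsTransportSolution.continuous_slice (hv : IsTransportSolution α N T v) {t : ℝ}
    (ht : t ∈ Ioc 0 T) (i : Fin 5) : Continuous fun p => v t p i :=
  (hv.smooth i).continuousOn.comp_continuous (f := fun p : ℝ => (t, p)) (by fun_prop)
    fun p => ⟨ht, mem_univ p⟩

/-- Finite speed of propagation, backwards in time. -/
theorem IsTransportSolution.eq_zero_of_lt_abs (hv : IsTransportSolution α N T v) (hs : 0 < s)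
    {lam K : ℝ} (hlam : 0 < lam) (hα : ∀ t ∈ Icc s T, ∀ i, |α t i| ≤ lam)
    (hN : ∀ t ∈ Icc s T, ∀ p, R < |p| → -K * ∑ i, v t p i ^ 2 ≤ ∑ i, 2 * v t p i * N t p i)
    (hT : ∀ p, R < |p| → v T p = 0) :
    ∀ t ∈ Icc s T, ∀ p, R + lam * (T - t) < |p| → v t p = 0 := by
  intro t₀ ht₀ p₀ hp₀
  rcases eq_or_lt_of_le ht₀.2 with heq | hlt
  · rw [heq]
    exact hT p₀ (by rw [heq] at hp₀; simpa using hp₀)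
  have ht₀0 : 0 < t₀ := hs.trans_le ht₀.1
  -- With this radius at time `t₀`, the cone around `p₀` that widens at speed `lam` stays in `R <
  -- |p|` up to time `T`.
  set ρ := |p₀| - (R + lam * (T - t₀)) with hρ
  have hρ0 : 0 < ρ := by linarith
  set Q : ℝ × ℝ → ℝ := fun y => (ρ + lam * (y.1 - t₀)) ^ 2 - (y.2 - p₀) ^ 2 with hQ
  -- A smooth weight positive exactly where `Q` is. Inside the widening cone it increases along
  -- every admissible characteristic, so the weighted energy obeys the Grönwall inequality; as it
  -- vanishes at `T`, it vanishes at `t₀`.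
  set w : ℝ × ℝ → ℝ := fun y => expNegInvGlue (Q y) with hw
  have hQpos : ∀ t ∈ Icc t₀ T, ∀ p, 0 < Q (t, p) → |p - p₀| < ρ + lam * (t - t₀) := by
    intro t ht p h
    have h1 : 0 ≤ lam * (t - t₀) := mul_nonneg hlam.le (sub_nonneg.2 ht.1)
    refine abs_lt_of_sq_lt_sq ?_ (by linarith)
    simp only [hQ] at h
    linarith
  have hdom : ∀ t ∈ Icc t₀ T, ∀ p, 0 < Q (t, p) → R < |p| ∧ |p| ≤ 2 * |p₀| - R := by
    intro t ht p h
    have h1 := hQpos t ht p h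
    have h2 : lam * (t - t₀) ≤ lam * (T - t₀) :=
      mul_le_mul_of_nonneg_left (by linarith [ht.2]) hlam.le
    have h3 := abs_sub_abs_le_abs_sub p₀ p
    rw [abs_sub_comm] at h3
    have h4 := abs_sub_abs_le_abs_sub p p₀
    constructor <;> linarith
  have hwsmooth : ContDiff ℝ 1 w := (expNegInvGlue.contDiff (n := 1)).comp (by fun_prop)
  have hfd : ∀ t p b, fderiv ℝ w (t, p) (1, b) = deriv expNegInvGlue (Q (t, p)) *
      (2 * (ρ + lam * (t - t₀)) * lam - 2 * (p - p₀) * b) := by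
    intro t p b
    have hdQ : DifferentiableAt ℝ Q (t, p) := by fun_prop
    have he : DifferentiableAt ℝ expNegInvGlue (Q (t, p)) :=
      (expNegInvGlue.contDiff (n := 1)).differentiable (by simp) _
    have hline : HasDerivAt (fun τ : ℝ => Q (t + τ * 1, p + τ * b))
        (2 * (ρ + lam * (t - t₀)) * lam - 2 * (p - p₀) * b) 0 := by
      have h1 : HasDerivAt (fun τ : ℝ => ρ + lam * (t + τ * 1 - t₀)) lam 0 := by
        simpa using (((((hasDerivAt_id' (0 : ℝ)).mul_const 1).const_add t).sub_const
          t₀).const_mul lam).const_add ρ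
      have h2 : HasDerivAt (fun τ : ℝ => p + τ * b - p₀) b 0 := by
        simpa using (((hasDerivAt_id' (0 : ℝ)).mul_const b).const_add p).sub_const p₀
      have h3 := (h1.fun_pow 2).fun_sub (h2.fun_pow 2)
      simpa using h3
    have hcurve : HasDerivAt (fun τ : ℝ => ((t + τ * 1, p + τ * b) : ℝ × ℝ)) (1, b) 0 := by
      have h1 := ((hasDerivAt_id' (0 : ℝ)).mul_const 1).const_add t
      have h2 := ((hasDerivAt_id' (0 : ℝ)).mul_const b).const_add p
      simpa using h1.prodMk h2
    have hwd : HasFDerivAt w (fderiv ℝ w (t, p)) (t + 0 * 1, p + 0 * b) := by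
      simpa using (hwsmooth.differentiable (by simp) (t, p)).hasFDerivAt
    have e1 := hwd.comp_hasDerivAt (0 : ℝ) hcurve
    have he' : HasDerivAt expNegInvGlue (deriv expNegInvGlue (Q (t, p)))
        (Q (t + 0 * 1, p + 0 * b)) := by
      simpa using he.hasDerivAt
    exact e1.unique (he'.comp (0 : ℝ) hline)
  have hvanish : ∀ t ∈ Icc t₀ T, ∀ p, 2 * |p₀| - R < |p| → ∀ i, w (t, p) * v t p i ^ 2 = 0 := by
    intro t ht p hp i
    by_cases h : 0 < Q (t, p)
    · exact absurd (hdom t ht p h).2 (not_le.2 hp)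
    · simp only [hw, expNegInvGlue.zero_of_nonpos (not_lt.1 h), zero_mul]
  have hF := hv.continuousOn_energy (W := fun _ => w)
    (fun _ => hwsmooth.continuous.continuousOn) ht₀0 hvanish
  have hle := le_of_deriv_ge (K := K) (k := 0) hF (fun t ht => ?_) hlt.le
  · have hFT : ∫ p, ∑ i, w (T, p) * v T p i ^ 2 = 0 := by
      rw [← integral_zero ℝ ℝ]
      congr 1
      ext p
      refine Finset.sum_eq_zero fun i _ => ?_
      by_cases h : 0 < Q (T, p)
      · rw [hT p (hdom T ⟨hlt.le, le_rfl⟩ p h).1]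
        simp
      · simp only [hw, expNegInvGlue.zero_of_nonpos (not_lt.1 h), zero_mul]
    rw [hFT] at hle
    simp only [add_zero, zero_mul] at hle
    by_contra hne
    obtain ⟨i, hi⟩ := Function.ne_iff.1 hne
    have hi : v t₀ p₀ i ≠ 0 := hi
    have hpos : 0 < ∑ i, w (t₀, p₀) * v t₀ p₀ i ^ 2 := by
      have hwp : 0 < w (t₀, p₀) := expNegInvGlue.pos_of_pos (by simp only [hQ]; simp; positivity)
      exact Finset.sum_pos' (fun j _ => by positivity) ⟨i, Finset.mem_univ i, by positivity⟩
    refine absurd hle (not_le.2 (Continuous.integral_pos_of_hasCompactSupport_nonneg_nonzero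
      ?_ ?_ ?_ hpos.ne'))
    · refine continuous_finsetSum _ fun i _ => ?_
      have := hv.continuous_slice ⟨ht₀0, hlt.le⟩ i
      have := hwsmooth.continuous
      fun_prop
    · refine HasCompactSupport.intro (isCompact_Icc (a := -(2 * |p₀| - R)) (b := 2 * |p₀| - R))
        fun p hp => Finset.sum_eq_zero fun i _ => hvanish t₀ ⟨le_rfl, hlt.le⟩ p ?_ i
      by_contra! h
      exact hp (abs_le.1 h)
    · exact fun p => Finset.sum_nonneg fun i _ => mul_nonneg (expNegInvGlue.nonneg _) (sq_nonneg _)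
  · have ht' : t ∈ Icc t₀ T := ⟨ht.1.le, ht.2.le⟩
    have hts : t ∈ Icc s T := ⟨ht₀.1.trans ht.1.le, ht.2.le⟩
    have hb : ∀ p, -K * ∑ i, w (t, p) * v t p i ^ 2 - 0 * (0 : ℝ) ≤
        ∑ i, (fderiv ℝ w (t, p) (1, α t i) * v t p i ^ 2 + 2 * w (t, p) * v t p i * N t p i) := by
      intro p
      by_cases h : 0 < Q (t, p)
      · have hwp : 0 ≤ w (t, p) := expNegInvGlue.nonneg _
        have hd : ∀ i, 0 ≤ fderiv ℝ w (t, p) (1, α t i) := by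
          intro i
          rw [hfd]
          refine mul_nonneg expNegInvGlue.monotone.deriv_nonneg ?_
          have := hQpos t ht' p h
          have h3 : (p - p₀) * α t i ≤ (ρ + lam * (t - t₀)) * lam := by
            refine (le_abs_self _).trans ?_
            rw [abs_mul]
            exact mul_le_mul this.le (hα t hts i) (abs_nonneg _) ((abs_nonneg _).trans this.le)
          linarith
        calc -K * ∑ i, w (t, p) * v t p i ^ 2 - 0 * 0
            = w (t, p) * (-K * ∑ i, v t p i ^ 2) := by
              rw [← Finset.mul_sum]
              ring
          _ ≤ w (t, p) * ∑ i, 2 * v t p i * N t p i :=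
              mul_le_mul_of_nonneg_left (hN t hts p (hdom t ht' p h).1) hwp
          _ = ∑ i, 2 * w (t, p) * v t p i * N t p i := by
              rw [Finset.mul_sum]
              exact Finset.sum_congr rfl fun i _ => by ring
          _ ≤ _ := Finset.sum_le_sum fun i _ =>
              le_add_of_nonneg_left (mul_nonneg (hd i) (sq_nonneg _))
      · have hw0 : w (t, p) = 0 := expNegInvGlue.zero_of_nonpos (not_lt.1 h)
        -- Where `Q ≤ 0` the function `expNegInvGlue` attains its minimum 0, hence its derivative
        -- vanishes there, including on the boundary of the cone.
        have hd0 : deriv expNegInvGlue (Q (t, p)) = 0 := by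
          refine IsLocalMin.deriv_eq_zero (Eventually.of_forall fun y => ?_)
          rw [expNegInvGlue.zero_of_nonpos (not_lt.1 h)]
          exact expNegInvGlue.nonneg _
        simp [hfd, hw0, hd0]
    obtain ⟨F', h1, h2⟩ := hv.exists_hasDerivAt_energy (W := fun _ => w) (γ := fun _ => 0)
      (K := K) (k := 0) (fun _ => hwsmooth.contDiffOn) ht₀0 hvanish (integrable_zero _ _ _) ht hb
    exact ⟨F', h1, by simpa using h2⟩

end Propagation

/-! ### Pointwise estimates for the density of the energy derivative -/

section EnergyEstimate

/-- The density of the second energy is the sum of the weighted squares of the components. -/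
noncomputable def energyWeight (c : ℝ) (i : Fin 5) (y : ℝ × ℝ) : ℝ :=
  if i = 4 then y.1 ^ (2 * c + 1) else y.1 ^ (2 * c)

noncomputable def energy (c : ℝ) (v : ℝ → ℝ → Fin 5 → ℝ) (t : ℝ) : ℝ :=
  ∫ p, ∑ i, energyWeight c i (t, p) * v t p i ^ 2

theorem contDiffOn_energyWeight (c : ℝ) (i : Fin 5) :
    ContDiffOn ℝ 1 (energyWeight c i) (Ioi 0 ×ˢ univ) := by
  intro y hy
  have hy : y.1 ≠ 0 := ne_of_gt hy.1
  refine ContDiffAt.contDiffWithinAt ?_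
  unfold energyWeight
  split_ifs
  · exact contDiffAt_fst.rpow_const_of_ne hy
  · exact contDiffAt_fst.rpow_const_of_ne hy

theorem fderiv_fst_rpow {t : ℝ} (ht : 0 < t) (p b r : ℝ) :
    fderiv ℝ (fun y : ℝ × ℝ => y.1 ^ r) (t, p) (1, b) = r * t ^ (r - 1) := by
  have h := (hasFDerivAt_fst (𝕜 := ℝ) (p := ((t, p) : ℝ × ℝ))).rpow_const (p := r)
    (Or.inl ht.ne')
  rw [h.fderiv]
  simp

theorem energyWeight_nonneg {c t : ℝ} (ht : 0 < t) (i : Fin 5) (p : ℝ) :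
    0 ≤ energyWeight c i (t, p) := by
  unfold energyWeight
  split_ifs <;> positivity

theorem energy_nonneg {c t : ℝ} (ht : 0 < t) (v : ℝ → ℝ → Fin 5 → ℝ) : 0 ≤ energy c v t :=
  integral_nonneg fun p => Finset.sum_nonneg fun i _ =>
    mul_nonneg (energyWeight_nonneg ht i p) (sq_nonneg _)

theorem sum_energyWeight {c t : ℝ} (ht : 0 < t) (p : ℝ) (w : Fin 5 → ℝ) :
    ∑ i, energyWeight c i (t, p) * w i ^ 2
      = t ^ (2 * c) * (w 0 ^ 2 + w 1 ^ 2 + w 2 ^ 2 + w 3 ^ 2 + t * w 4 ^ 2) := by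
  rw [Fin.sum_univ_five]
  simp [energyWeight, Real.rpow_add ht]
  ring

/-- The density of the time derivative of the second energy. -/
theorem sum_energyWeight_deriv {c t : ℝ} (ht : 0 < t) (p : ℝ) (b w n : Fin 5 → ℝ) :
    ∑ i, (fderiv ℝ (energyWeight c i) (t, p) (1, b i) * w i ^ 2
        + 2 * energyWeight c i (t, p) * w i * (n i / t))
      = t ^ (2 * c - 1) * (2 * c * (w 0 ^ 2 + w 1 ^ 2 + w 2 ^ 2 + w 3 ^ 2)
        + 2 * (w 0 * n 0 + w 1 * n 1 + w 2 * n 2 + w 3 * n 3)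
        + (2 * c + 1) * t * w 4 ^ 2 + 2 * t * (w 4 * n 4)) := by
  have e1 : t ^ (2 * c) = t ^ (2 * c - 1) * t := by
    rw [← Real.rpow_add_one ht.ne']
    ring_nf
  have e2 : t ^ (2 * c + 1) = t ^ (2 * c - 1) * t * t := by
    rw [Real.rpow_add_one ht.ne', e1]
  have hd : ∀ i : Fin 5, i ≠ 4 → ∀ b, fderiv ℝ (energyWeight c i) (t, p) (1, b)
      = 2 * c * t ^ (2 * c - 1) := by
    intro i hi b
    rw [show energyWeight c i = fun y : ℝ × ℝ => y.1 ^ (2 * c) by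
      ext y; simp [energyWeight, hi], fderiv_fst_rpow ht]
  have hd4 : ∀ b, fderiv ℝ (energyWeight c 4) (t, p) (1, b)
      = (2 * c + 1) * (t ^ (2 * c - 1) * t) := by
    intro b
    rw [show energyWeight c 4 = fun y : ℝ × ℝ => y.1 ^ (2 * c + 1) by
      ext y; simp [energyWeight], fderiv_fst_rpow ht, ← e1]
    ring_nf
  rw [Fin.sum_univ_five, hd 0 (by decide), hd 1 (by decide), hd 2 (by decide), hd 3 (by decide),
    hd4]
  simp only [energyWeight, Fin.reduceEq, if_true, if_false, e1, e2]
  field_simp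
  ring

/-- Cauchy-Schwarz bound for the density of the time derivative of the second energy. -/
theorem density_lower_bound {c t M e γ : ℝ} {w n : Fin 5 → ℝ} (ht : 0 < t)
    (hn : ∀ i, i ≠ 4 →
      |n i| ≤ M * t * (|w 0| + |w 1| + |w 2| + |w 3| + |w 4| + γ))
    (h4 : |n 4 + e * w 4| ≤ M * (|w 0| + |w 1| + |w 2| + |w 3| + γ)) :
    2 * c * (w 0 ^ 2 + w 1 ^ 2 + w 2 ^ 2 + w 3 ^ 2)
      - 2 * M * t * (|w 0| + |w 1| + |w 2| + |w 3|)
        * (|w 0| + |w 1| + |w 2| + |w 3| + |w 4| + γ)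
      + t * w 4 ^ 2 * (1 + 2 * (c - e)) - 2 * t * M * |w 4| * (|w 0| + |w 1| + |w 2| + |w 3| + γ)
    ≤ 2 * c * (w 0 ^ 2 + w 1 ^ 2 + w 2 ^ 2 + w 3 ^ 2)
        + 2 * (w 0 * n 0 + w 1 * n 1 + w 2 * n 2 + w 3 * n 3)
        + (2 * c + 1) * t * w 4 ^ 2 + 2 * t * (w 4 * n 4) := by
  have hi : ∀ i, i ≠ 4 → -(|w i| * (M * t * (|w 0| + |w 1| + |w 2| + |w 3| + |w 4| + γ)))
      ≤ w i * n i := by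
    intro i hi
    refine (neg_le_neg (mul_le_mul_of_nonneg_left (hn i hi) (abs_nonneg (w i)))).trans ?_
    rw [← abs_mul]
    exact neg_abs_le _
  have h5 : -(|w 4| * (M * (|w 0| + |w 1| + |w 2| + |w 3| + γ))) ≤ w 4 * (n 4 + e * w 4) := by
    refine (neg_le_neg (mul_le_mul_of_nonneg_left h4 (abs_nonneg (w 4)))).trans ?_
    rw [← abs_mul]
    exact neg_abs_le _
  have h6 := mul_le_mul_of_nonneg_left h5 (by positivity : 0 ≤ 2 * t)
  linarith [hi 0 (by decide), hi 1 (by decide), hi 2 (by decide), hi 3 (by decide)]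

theorem sq_abs_add_le (w : Fin 5 → ℝ) :
    (|w 0| + |w 1| + |w 2| + |w 3|) ^ 2 ≤ 4 * (w 0 ^ 2 + w 1 ^ 2 + w 2 ^ 2 + w 3 ^ 2) := by
  rw [← sq_abs (w 0), ← sq_abs (w 1), ← sq_abs (w 2), ← sq_abs (w 3)]
  nlinarith [sq_nonneg (|w 0| - |w 1|), sq_nonneg (|w 0| - |w 2|), sq_nonneg (|w 0| - |w 3|),
    sq_nonneg (|w 1| - |w 2|), sq_nonneg (|w 1| - |w 3|), sq_nonneg (|w 2| - |w 3|)]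

/-- Half of `t y²` survives since `e ≤ c + 1/4`, and is split as `1/8 + 1/8 + 1/4`. The inequalities
`4Mm|y| ≤ 32M²m² + y²/8`, `2M|y|γ ≤ 8M²γ² + y²/8` and `2Mmγ ≤ M²γ² + m²` leave `9M²γ²` and `t m²(2M
+ 32M² + 1) ≤ m² ≤ 4P`. The last is absorbed by `2cP` because `c ≥ 2`. -/
theorem near_quadratic_bound {c t M e γ P m y : ℝ} (ht : 0 < t) (hc : 2 ≤ c)
    (he : e ≤ c + 1 / 4) (htM : t * (2 * M + 32 * M ^ 2 + 1) ≤ 1) (hm : m ^ 2 ≤ 4 * P) :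
    -(9 * M ^ 2) * t * γ ^ 2 ≤ 2 * c * P - 2 * M * t * m * (m + |y| + γ)
      + t * y ^ 2 * (1 + 2 * (c - e)) - 2 * t * M * |y| * (m + γ) := by
  have hP : 0 ≤ P := by nlinarith [sq_nonneg m]
  have h1 : 4 * P ≤ 2 * c * P := by nlinarith
  have h2 : t * (y ^ 2 * (1 / 2)) ≤ t * y ^ 2 * (1 + 2 * (c - e)) := by
    rw [mul_assoc]
    exact mul_le_mul_of_nonneg_left
      (mul_le_mul_of_nonneg_left (by linarith) (sq_nonneg y)) ht.le
  have h3 : t * (m ^ 2 * (2 * M + 32 * M ^ 2 + 1)) ≤ 4 * P := by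
    nlinarith [mul_le_mul_of_nonneg_left htM (sq_nonneg m)]
  have h4 : 0 ≤ t * ((32 * M ^ 2 * m ^ 2 + y ^ 2 / 8 - 4 * M * m * |y|)
      + (8 * M ^ 2 * γ ^ 2 + y ^ 2 / 8 - 2 * M * |y| * γ)
      + (M ^ 2 * γ ^ 2 + m ^ 2 - 2 * M * m * γ) + y ^ 2 / 4) := by
    refine mul_nonneg ht.le ?_
    rw [← sq_abs y]
    nlinarith [sq_nonneg (16 * M * m - |y|), sq_nonneg (8 * M * γ - |y|), sq_nonneg (M * γ - m),
      sq_nonneg |y|]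
  nlinarith

/-- No smallness of `t` and no sign of `c - e` is available here, so every term is estimated
crudely, at the cost of a Grönwall constant. -/
theorem far_quadratic_bound {c t M e γ P m y : ℝ} (ht : 0 < t) (hc : 2 ≤ c) (hM : 0 ≤ M)
    (he : e ≤ M) (hm : m ^ 2 ≤ 4 * P) :
    -(20 * M) * t * (P + y ^ 2 + γ ^ 2) ≤ 2 * c * P - 2 * M * t * m * (m + |y| + γ)
      + t * y ^ 2 * (1 + 2 * (c - e)) - 2 * t * M * |y| * (m + γ) := by
  have hP : 0 ≤ P := by nlinarith [sq_nonneg m]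
  have h1 : 0 ≤ 2 * c * P := by positivity
  have h2 : -(2 * M) * (t * y ^ 2) ≤ t * y ^ 2 * (1 + 2 * (c - e)) := by
    have : 0 ≤ t * y ^ 2 := by positivity
    nlinarith
  have h4 : 0 ≤ t * M * (20 * (P + y ^ 2 + γ ^ 2) - 2 * m * (m + |y| + γ) - 2 * y ^ 2
      - 2 * |y| * (m + γ)) := by
    refine mul_nonneg (by positivity) ?_
    rw [← sq_abs y]
    nlinarith [sq_nonneg (m - |y|), sq_nonneg (m - γ), sq_nonneg (|y| - γ), sq_nonneg |y|,
      sq_nonneg γ, sq_nonneg m]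
  nlinarith

variable {a zc c : ℝ} {l : ℕ}

/-- The right hand side of the system, solved for the transport derivatives. -/
noncomputable def systemRhs (a : ℝ) (l : ℕ) (zc : ℝ) (G v : ℝ → ℝ → Fin 5 → ℝ) (t p : ℝ)
    (i : Fin 5) : ℝ := (-(C a l zc t *ᵥ v t p) i + G t p i) / t

/-- The characteristic speeds. -/
noncomputable def speed (a zc t : ℝ) (i : Fin 5) : ℝ := Atilde a (zc + t) i i

/-- The time slices are compactly supported, locally uniformly in `t ∈ (0, T]`. -/
def HasLocallyUniformSupport (T : ℝ) (v : ℝ → ℝ → Fin 5 → ℝ) : Prop :=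
  ∀ s > 0, ∃ R, ∀ t ∈ Icc s T, ∀ p, R < |p| → v t p = 0

/-- The bound for a source which vanishes at the horizon except for its last component. -/
def SourceBound (M : ℝ) (G : ℝ → ℝ → Fin 5 → ℝ) (γ : ℝ → ℝ) (t : ℝ) : Prop :=
  ∀ p, (∀ i, i ≠ 4 → |G t p i| ≤ M * t * γ p) ∧ |G t p 4| ≤ M * γ p

/-- The coefficient bound at a given time. -/
def CoefficientBound (M : ℝ) (B : Matrix (Fin 5) (Fin 5) ℝ) (t : ℝ) : Prop :=
  (∀ i j, i ≠ 4 → |B i j| ≤ M * t) ∧ ∀ j, |B 4 j| ≤ M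

/-- The diagonal term of the last row is kept exact: it has to be compared with `c`, and bounding it
by `M` would destroy the positivity of the coefficient of `t y²`. -/
theorem CoefficientBound.abs_mulVec_le {M t : ℝ} {B : Matrix (Fin 5) (Fin 5) ℝ}
    (hB : CoefficientBound M B t) (w : Fin 5 → ℝ) :
    (∀ i, i ≠ 4 → |(B *ᵥ w) i| ≤ M * t * (|w 0| + |w 1| + |w 2| + |w 3| + |w 4|)) ∧
      |(B *ᵥ w) 4 - B 4 4 * w 4| ≤ M * (|w 0| + |w 1| + |w 2| + |w 3|) := by
  have hexp : ∀ i, (B *ᵥ w) i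
      = B i 0 * w 0 + B i 1 * w 1 + B i 2 * w 2 + B i 3 * w 3 + B i 4 * w 4 := by
    intro i
    simp [Matrix.mulVec, dotProduct, Fin.sum_univ_five]
  have hmul : ∀ {b L : ℝ} (y : ℝ), |b| ≤ L → |b * y| ≤ L * |y| := fun y h => by
    rw [abs_mul]
    exact mul_le_mul_of_nonneg_right h (abs_nonneg y)
  constructor
  · intro i hi
    have h := fun j => abs_le.1 (hmul (w j) (hB.1 i j hi))
    rw [hexp, abs_le]
    constructor <;>
      linarith [(h 0).1, (h 1).1, (h 2).1, (h 3).1, (h 4).1, (h 0).2, (h 1).2, (h 2).2, (h 3).2,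
        (h 4).2]
  · have h := fun j => abs_le.1 (hmul (w j) (hB.2 j))
    rw [hexp, abs_le]
    constructor <;>
      linarith [(h 0).1, (h 1).1, (h 2).1, (h 3).1, (h 0).2, (h 1).2, (h 2).2, (h 3).2]

theorem systemRhs_density_lower_bound {M t p : ℝ} (ht : 0 < t) {G v : ℝ → ℝ → Fin 5 → ℝ}
    {γ : ℝ → ℝ} (hB : CoefficientBound M (C a l zc t) t) (hG : SourceBound M G γ t)
    (b : Fin 5 → ℝ) :
    t ^ (2 * c - 1) * (2 * c * (v t p 0 ^ 2 + v t p 1 ^ 2 + v t p 2 ^ 2 + v t p 3 ^ 2)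
      - 2 * M * t * (|v t p 0| + |v t p 1| + |v t p 2| + |v t p 3|)
        * (|v t p 0| + |v t p 1| + |v t p 2| + |v t p 3| + |v t p 4| + γ p)
      + t * v t p 4 ^ 2 * (1 + 2 * (c - C a l zc t 4 4))
      - 2 * t * M * |v t p 4| * (|v t p 0| + |v t p 1| + |v t p 2| + |v t p 3| + γ p))
    ≤ ∑ i, (fderiv ℝ (energyWeight c i) (t, p) (1, b i) * v t p i ^ 2
        + 2 * energyWeight c i (t, p) * v t p i * systemRhs a l zc G v t p i) := by
  unfold systemRhs
  rw [sum_energyWeight_deriv ht p b (v t p) fun i => -(C a l zc t *ᵥ v t p) i + G t p i]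
  obtain ⟨h1, h2⟩ := hB.abs_mulVec_le (v t p)
  refine mul_le_mul_of_nonneg_left (density_lower_bound (c := c) (e := C a l zc t 4 4)
    (w := v t p) (n := fun i => -(C a l zc t *ᵥ v t p) i + G t p i) (γ := γ p) ht
    (fun i hi => ?_) ?_) (by positivity)
  · have h3 := abs_le.1 (h1 i hi)
    have h4 := abs_le.1 ((hG p).1 i hi)
    rw [abs_le]
    constructor <;> linarith
  · have h3 := abs_le.1 h2
    have h4 := abs_le.1 (hG p).2
    rw [abs_le]
    constructor <;> linarith

end EnergyEstimate

/-! ### Near monotonicity at the horizon and Grönwall away from it -/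

section SystemEstimates

variable {a zc c M T : ℝ} {l : ℕ} {G v : ℝ → ℝ → Fin 5 → ℝ} {γ : ℝ → ℝ}

theorem systemRhs_density_near {t : ℝ} (ht : 0 < t) (ht1 : t ≤ 1) (hc : 2 ≤ c)
    (he : C a l zc t 4 4 ≤ c + 1 / 4) (htM : t * (2 * M + 32 * M ^ 2 + 1) ≤ 1)
    (hB : CoefficientBound M (C a l zc t) t) (hG : SourceBound M G γ t) (b : Fin 5 → ℝ) (p : ℝ) :
    -(9 * M ^ 2 * t) * γ p ^ 2 ≤ ∑ i, (fderiv ℝ (energyWeight c i) (t, p) (1, b i) * v t p i ^ 2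
        + 2 * energyWeight c i (t, p) * v t p i * systemRhs a l zc G v t p i) := by
  refine le_trans ?_ (systemRhs_density_lower_bound ht hB hG b)
  have h := mul_le_mul_of_nonneg_left
    (near_quadratic_bound (γ := γ p) (y := v t p 4) ht hc he htM (sq_abs_add_le (v t p)))
    (by positivity : 0 ≤ t ^ (2 * c - 1))
  refine le_trans ?_ h
  have h1 : t ^ (2 * c - 1) ≤ 1 := Real.rpow_le_one ht.le ht1 (by linarith)
  have h2 : 0 ≤ 9 * M ^ 2 * t * γ p ^ 2 := by positivity
  nlinarith

/-- The energy weighs the fifth square by `t`, so on `[s, T]` it is recovered at the cost of `1/s`;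
`T ^ (2 * c)` bounds the weight in front of the source. -/
theorem systemRhs_density_far {s t : ℝ} (hs : 0 < s) (ht : t ∈ Icc s T) (hc : 2 ≤ c)
    (hM : 0 ≤ M) (hB : CoefficientBound M (C a l zc t) t) (hG : SourceBound M G γ t)
    (b : Fin 5 → ℝ) (p : ℝ) :
    -(20 * M * (1 + 1 / s + T ^ (2 * c))) * ∑ i, energyWeight c i (t, p) * v t p i ^ 2
        - (20 * M * (1 + 1 / s + T ^ (2 * c))) * γ p ^ 2
      ≤ ∑ i, (fderiv ℝ (energyWeight c i) (t, p) (1, b i) * v t p i ^ 2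
        + 2 * energyWeight c i (t, p) * v t p i * systemRhs a l zc G v t p i) := by
  have ht0 : 0 < t := hs.trans_le ht.1
  refine le_trans ?_ (systemRhs_density_lower_bound ht0 hB hG b)
  have h := mul_le_mul_of_nonneg_left
    (far_quadratic_bound (γ := γ p) (y := v t p 4) ht0 hc hM
      ((le_abs_self _).trans (hB.2 4)) (sq_abs_add_le (v t p)))
    (by positivity : 0 ≤ t ^ (2 * c - 1))
  refine le_trans ?_ h
  rw [sum_energyWeight ht0]
  have e1 : t ^ (2 * c) = t ^ (2 * c - 1) * t := by
    rw [← Real.rpow_add_one ht0.ne']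
    ring_nf
  have h1 : t ^ (2 * c) ≤ T ^ (2 * c) := Real.rpow_le_rpow ht0.le ht.2 (by linarith)
  have h2 : t ^ (2 * c - 1) * (-(20 * M) * t
      * (v t p 0 ^ 2 + v t p 1 ^ 2 + v t p 2 ^ 2 + v t p 3 ^ 2 + v t p 4 ^ 2 + γ p ^ 2))
      = -(20 * M) * (t ^ (2 * c)
      * (v t p 0 ^ 2 + v t p 1 ^ 2 + v t p 2 ^ 2 + v t p 3 ^ 2 + v t p 4 ^ 2 + γ p ^ 2)) := by
    rw [e1]
    ring
  have h3 : v t p 4 ^ 2 ≤ (1 / s) * (t * v t p 4 ^ 2) := by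
    rw [one_div, ← div_eq_inv_mul, le_div_iff₀ hs, mul_comm]
    exact mul_le_mul_of_nonneg_right ht.1 (sq_nonneg _)
  set P := v t p 0 ^ 2 + v t p 1 ^ 2 + v t p 2 ^ 2 + v t p 3 ^ 2
  have hP : 0 ≤ P := by positivity
  have hτ : 0 ≤ t ^ (2 * c) := by positivity
  have hT : 0 ≤ T ^ (2 * c) := hτ.trans h1
  have hs' : 0 ≤ 1 / s := by positivity
  have h4 : t ^ (2 * c) * (P + v t p 4 ^ 2 + γ p ^ 2) ≤
      (1 + 1 / s + T ^ (2 * c)) * (t ^ (2 * c) * (P + t * v t p 4 ^ 2))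
        + (1 + 1 / s + T ^ (2 * c)) * γ p ^ 2 := by
    have k1 : t ^ (2 * c) * γ p ^ 2 ≤ (1 + 1 / s + T ^ (2 * c)) * γ p ^ 2 :=
      mul_le_mul_of_nonneg_right (by linarith) (sq_nonneg _)
    have k2 : P + v t p 4 ^ 2 ≤ (1 + 1 / s + T ^ (2 * c)) * (P + t * v t p 4 ^ 2) := by
      have : 0 ≤ t * v t p 4 ^ 2 := by positivity
      nlinarith [mul_nonneg hs' hP, mul_nonneg hT hP, mul_nonneg hT this]
    have k3 := mul_le_mul_of_nonneg_left k2 hτ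
    linarith
  rw [h2]
  have h5 := mul_le_mul_of_nonneg_left h4 (by positivity : 0 ≤ 20 * M)
  linarith

section Energy

variable {α : ℝ → Fin 5 → ℝ} {N : ℝ → ℝ → Fin 5 → ℝ}
  (hv : IsTransportSolution α N T v) (hsupp : HasLocallyUniformSupport T v)
include hv hsupp

theorem IsTransportSolution.continuousOn_energy_Icc {s : ℝ} (hs : 0 < s) :
    ContinuousOn (energy c v) (Icc s T) := by
  obtain ⟨R, hR⟩ := hsupp s hs
  exact hv.continuousOn_energy (R := R) (fun i => (contDiffOn_energyWeight c i).continuousOn) hs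
    fun t ht p hp i => by simp [hR t ht p hp]

theorem IsTransportSolution.continuousOn_energy_Ioc : ContinuousOn (energy c v) (Ioc 0 T) := by
  intro t ht
  refine ((hv.continuousOn_energy_Icc hsupp (half_pos ht.1)) t
    ⟨by linarith [ht.1], ht.2⟩).mono_of_mem_nhdsWithin ?_
  filter_upwards [self_mem_nhdsWithin, mem_nhdsWithin_of_mem_nhds
    (Ioi_mem_nhds (by linarith [ht.1] : t / 2 < t))] with τ h1 h2
  exact ⟨le_of_lt h2, h1.2⟩

theorem IsTransportSolution.exists_hasDerivAt_energyWeight {t : ℝ} (ht : t ∈ Ioo 0 T)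
    (hγ : Integrable fun p => γ p ^ 2) {K k : ℝ}
    (hbound : ∀ p, -K * ∑ i, energyWeight c i (t, p) * v t p i ^ 2 - k * γ p ^ 2 ≤
      ∑ i, (fderiv ℝ (energyWeight c i) (t, p) (1, α t i) * v t p i ^ 2
        + 2 * energyWeight c i (t, p) * v t p i * N t p i)) :
    ∃ F', HasDerivAt (energy c v) F' t ∧
      -K * energy c v t - k * ∫ p, γ p ^ 2 ≤ F' := by
  obtain ⟨R, hR⟩ := hsupp (t / 2) (half_pos ht.1)
  exact hv.exists_hasDerivAt_energy (R := R) (contDiffOn_energyWeight c) (half_pos ht.1)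
    (fun τ hτ p hp i => by simp [hR τ hτ p hp]) hγ ⟨by linarith [ht.1], ht.2⟩ hbound

end Energy

variable (ha : 0 < a) (hzc : IsCauchyHorizon a zc) (hc : IsExponent a l zc c)
include ha hzc hc

/-- Near the horizon, the second energy is nearly monotone. -/
theorem IsCauchyHorizon.exists_energy_near (M : ℝ) :
    ∃ δ > 0, ∃ k > 0, ∀ (T : ℝ) (G v : ℝ → ℝ → Fin 5 → ℝ) (γ : ℝ → ℝ),
      IsTransportSolution (speed a zc) (systemRhs a l zc G v) T v →
      HasLocallyUniformSupport T v → (Integrable fun p => γ p ^ 2) →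
      (∀ t ∈ Ioc 0 (min δ T), CoefficientBound M (C a l zc t) t ∧ SourceBound M G γ t) →
      ∀ s t, 0 < s → s ≤ t → t ≤ min δ T →
        energy c v s ≤ energy c v t + k * t * (t - s) * ∫ p, γ p ^ 2 := by
  obtain ⟨hc2, -⟩ := hzc.tendsto_div_hPlus ha hc
  have hev := hc.eventually_le_const (by linarith : c < c + 1 / 4)
  obtain ⟨δ, hδ, hδC⟩ := mem_nhdsGT_iff_exists_Ioc_subset.1 hev
  have hδ : 0 < δ := hδ
  set B := |2 * M + 32 * M ^ 2 + 1| + 1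
  have hB : 0 < B := by positivity
  -- The three bounds on `t` ensure that `C_55 ≤ c + 1/4`, that `t ^ (2c - 1) ≤ 1` and that the
  -- cross terms can be absorbed. All are independent of `T` and of the solution; the 1 added to `9
  -- * M ^ 2` only secures `k > 0`.
  refine ⟨min δ (min 1 (1 / B)), by positivity, 9 * M ^ 2 + 1, by positivity, ?_⟩
  intro T G v γ hv hsupp hγ hbd s t hs hst htT
  have hΓ : 0 ≤ ∫ p, γ p ^ 2 := integral_nonneg fun p => sq_nonneg _
  have hmain := le_add_of_deriv_ge (k := (9 * M ^ 2 + 1) * t * ∫ p, γ p ^ 2)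
    ((hv.continuousOn_energy_Icc (c := c) hsupp hs).mono
      (Icc_subset_Icc_right (htT.trans (min_le_right _ _)))) (fun τ hτ => ?_) hst
  · linarith
  have hτ0 : 0 < τ := hs.trans hτ.1
  have hτT : τ < min (min δ (min 1 (1 / B))) T := hτ.2.trans_le htT
  have h1 : τ ≤ δ := hτT.le.trans ((min_le_left _ _).trans (min_le_left _ _))
  have h2 : τ ≤ 1 := hτT.le.trans ((min_le_left _ _).trans
    ((min_le_right _ _).trans (min_le_left _ _)))
  have h3 : τ ≤ 1 / B := hτT.le.trans ((min_le_left _ _).trans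
    ((min_le_right _ _).trans (min_le_right _ _)))
  have h4 : τ * (2 * M + 32 * M ^ 2 + 1) ≤ 1 := by
    rw [le_div_iff₀ hB] at h3
    refine (mul_le_mul_of_nonneg_left ?_ hτ0.le).trans h3
    exact (le_abs_self _).trans (le_add_of_nonneg_right zero_le_one)
  obtain ⟨b1, b2⟩ := hbd τ ⟨hτ0, hτT.le⟩
  obtain ⟨F', hF', hle⟩ := hv.exists_hasDerivAt_energyWeight (c := c) hsupp (K := 0)
    (k := 9 * M ^ 2 * τ) ⟨hτ0, hτT.trans_le (min_le_right _ _)⟩ hγ fun p => by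
      have := systemRhs_density_near (v := v) hτ0 h2 hc2 (hδC ⟨hτ0, h1⟩) h4 b1 b2
        (speed a zc τ) p
      linarith
  refine ⟨F', hF', ?_⟩
  have h5 : 9 * M ^ 2 * τ ≤ (9 * M ^ 2 + 1) * t :=
    mul_le_mul (by linarith) hτ.2.le hτ0.le (by positivity)
  have := mul_le_mul_of_nonneg_right h5 hΓ
  linarith

/-- The a priori bound of the second energy away from the horizon. -/
theorem IsCauchyHorizon.exists_energy_bound (hM : 0 ≤ M) (hT0 : 0 < T)
    (hB : ∀ t ∈ Ioc 0 T, CoefficientBound M (C a l zc t) t) :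
    ∃ ν > 0, ∀ (G v : ℝ → ℝ → Fin 5 → ℝ) (γ : ℝ → ℝ),
      IsTransportSolution (speed a zc) (systemRhs a l zc G v) T v →
      HasLocallyUniformSupport T v → (Integrable fun p => γ p ^ 2) →
      (∀ t ∈ Ioc 0 T, SourceBound M G γ t) →
      ∀ t ∈ Ioc 0 T, energy c v t ≤ ν * (energy c v T + ∫ p, γ p ^ 2) := by
  obtain ⟨hc2, -⟩ := hzc.tendsto_div_hPlus ha hc
  obtain ⟨δ, hδ, k, hk, hnear⟩ := hzc.exists_energy_near ha hc M
  set s := min δ T with hs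
  have hs0 : 0 < s := lt_min hδ hT0
  set K := 20 * M * (1 + 1 / s + T ^ (2 * c)) with hK
  have hK0 : 0 ≤ K := by positivity
  -- The exponential comes from Grönwall on `[s, T]`; `k * s * s` is the source loss incurred from
  -- `s` down to the horizon.
  refine ⟨Real.exp (K * T) + k * s * s, by positivity, ?_⟩
  intro G v γ hv hsupp hγ hG t ht
  have hΓ : 0 ≤ ∫ p, γ p ^ 2 := integral_nonneg fun p => sq_nonneg _
  have hET := energy_nonneg (c := c) hT0 v
  have hfar : ∀ τ ∈ Icc s T,
      energy c v τ ≤ Real.exp (K * T) * (energy c v T + ∫ p, γ p ^ 2) := by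
    intro τ hτ
    have hτ0 : 0 < τ := hs0.trans_le hτ.1
    have h := le_of_deriv_ge (K := K) (k := ∫ p, γ p ^ 2)
      (hv.continuousOn_energy_Icc (c := c) hsupp hτ0) (fun r hr => ?_) hτ.2
    · have h1 : Real.exp (K * (T - τ)) ≤ Real.exp (K * T) :=
        Real.exp_le_exp.2 (mul_le_mul_of_nonneg_left (by linarith) hK0)
      have h2 := mul_le_mul_of_nonneg_left h1 (add_nonneg hET hΓ)
      linarith
    · have hr0 : 0 < r := hτ0.trans hr.1
      exact hv.exists_hasDerivAt_energyWeight hsupp ⟨hr0, hr.2⟩ hγ fun p =>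
        systemRhs_density_far hs0 ⟨hτ.1.trans hr.1.le, hr.2.le⟩ hc2 hM (hB r ⟨hr0, hr.2.le⟩)
          (hG r ⟨hr0, hr.2.le⟩) _ p
  have hks : 0 ≤ k * s * s := by positivity
  rcases le_total s t with h | h
  · have := hfar t ⟨h, ht.2⟩
    have := mul_nonneg hks (add_nonneg hET hΓ)
    linarith
  · have h1 := hnear T G v γ hv hsupp hγ
      (fun τ hτ => ⟨hB τ ⟨hτ.1, hτ.2.trans (min_le_right _ _)⟩,
        hG τ ⟨hτ.1, hτ.2.trans (min_le_right _ _)⟩⟩) t s ht.1 h le_rfl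
    have h2 := hfar s ⟨le_rfl, min_le_right _ _⟩
    have h3 : k * s * (s - t) * ∫ p, γ p ^ 2 ≤ k * s * s * ∫ p, γ p ^ 2 :=
      mul_le_mul_of_nonneg_right
        (mul_le_mul_of_nonneg_left (by linarith [ht.1]) (by positivity)) hΓ
    have h4 := mul_nonneg hks hET
    linarith

end SystemEstimates

/-! ### The given system as a transport system -/

section Solutions

variable {a zc c T : ℝ} {l : ℕ} {f : ℝ → Fin 5 → ℝ} {g : ℝ → ℝ} {u : ℝ → ℝ → Fin 5 → ℝ}

theorem A_mulVec (t : ℝ) (w : Fin 5 → ℝ) (i : Fin 5) :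
    (A a zc t *ᵥ w) i = t * (speed a zc t i * w i) := by
  simp only [A, speed, Matrix.smul_mulVec, Pi.smul_apply, smul_eq_mul]
  simp only [Atilde, Matrix.mulVec_diagonal, Matrix.diagonal_apply_eq]

theorem IsSolution.isTransportSolution (hu : IsSolution a l zc T f g u) :
    IsTransportSolution (speed a zc) (systemRhs a l zc (fun t p => g p • source a zc t) u) T u where
  smooth i := (contDiffOn_pi.1 hu.smooth i).of_le (by exact_mod_cast le_top)
  equation t ht p i := by
    have hnhds : Ioc 0 T ×ˢ (univ : Set ℝ) ∈ 𝓝 (t, p) :=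
      prod_mem_nhds (Ioc_mem_nhds ht.1 ht.2) univ_mem
    obtain ⟨L, hL⟩ := ((hu.smooth.contDiffAt hnhds).differentiableAt (by simp))
    have h1 : HasDerivAt (fun s => u s p) (L (1, 0)) t :=
      hL.comp_hasDerivAt (f := fun s => (s, p)) t
        ((hasDerivAt_id' t).prodMk (hasDerivAt_const t p))
    have h2 : HasDerivAt (u t) (L (0, 1)) p :=
      hL.comp_hasDerivAt (f := fun s => (t, s)) p
        ((hasDerivAt_const p t).prodMk (hasDerivAt_id' p))
    have h3 : HasFDerivAt (fun y : ℝ × ℝ => u y.1 y.2 i)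
        ((ContinuousLinearMap.proj (R := ℝ) (φ := fun _ : Fin 5 => ℝ) i).comp L) (t, p) :=
      hasFDerivAt_pi'.1 hL i
    have heq := congrFun (hu.equation t ⟨ht.1, ht.2.le⟩ p) i
    rw [derivWithin_of_mem_nhds (Ioc_mem_nhds ht.1 ht.2), h1.deriv, h2.deriv] at heq
    simp only [Pi.add_apply, Pi.smul_apply, smul_eq_mul, A_mulVec] at heq
    have hsplit : L (1, speed a zc t i) = L (1, 0) + speed a zc t i • L (0, 1) := by
      rw [← map_smul, ← map_add]
      simp
    rw [h3.fderiv]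
    simp only [ContinuousLinearMap.comp_apply, ContinuousLinearMap.proj_apply, hsplit,
      Pi.add_apply, Pi.smul_apply, smul_eq_mul, systemRhs]
    rw [eq_div_iff ht.1.ne']
    linarith

theorem sum_mul_mulVec_le {B : Matrix (Fin 5) (Fin 5) ℝ} {M : ℝ} (hB : ∀ i j, |B i j| ≤ M)
    (w : Fin 5 → ℝ) : ∑ i, w i * (B *ᵥ w) i ≤ 5 * M * ∑ i, w i ^ 2 := by
  have h : ∀ i j, w i * (B i j * w j) ≤ M / 2 * (w i ^ 2 + w j ^ 2) := by
    intro i j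
    have h1 := hB i j
    calc w i * (B i j * w j) ≤ |w i * (B i j * w j)| := le_abs_self _
      _ = |B i j| * (|w i| * |w j|) := by
        rw [abs_mul, abs_mul]
        ring
      _ ≤ M * (|w i| * |w j|) := mul_le_mul_of_nonneg_right h1 (by positivity)
      _ ≤ M / 2 * (w i ^ 2 + w j ^ 2) := by
        rw [← sq_abs (w i), ← sq_abs (w j)]
        have : 0 ≤ M := (abs_nonneg _).trans h1
        nlinarith [mul_nonneg this (sq_nonneg (|w i| - |w j|))]
  calc ∑ i, w i * (B *ᵥ w) i = ∑ i, ∑ j, w i * (B i j * w j) := by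
        simp only [Matrix.mulVec, dotProduct, Finset.mul_sum]
    _ ≤ ∑ i, ∑ j, M / 2 * (w i ^ 2 + w j ^ 2) :=
        Finset.sum_le_sum fun i _ => Finset.sum_le_sum fun j _ => h i j
    _ = 5 * M * ∑ i, w i ^ 2 := by
        simp only [Fin.sum_univ_five]
        ring

/-- Outside the supports of `f` and `g` the equation is homogeneous with coefficients bounded on
`[s, T]`, so finite propagation confines all slices with `t ≥ s` to one bounded interval. This
justifies differentiating under the integral. -/
theorem IsSolution.hasLocallyUniformSupport (ha : 0 < a) (hzc : IsCauchyHorizon a zc)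
    (hc : IsExponent a l zc c) (hT : zc + T < 0) (hf : IsTest f) (hg : IsTest g)
    (hu : IsSolution a l zc T f g u) : HasLocallyUniformSupport T u := by
  intro s hs
  obtain ⟨R₁, -, hR₁⟩ := hf.2.exists_pos_le_norm
  obtain ⟨R₂, -, hR₂⟩ := hg.2.exists_pos_le_norm
  obtain ⟨lam, hlam, hspeed⟩ := hzc.exists_speed_bound ha hs hT
  obtain ⟨M, hM, hcoef⟩ := hzc.exists_coefficient_bound ha hc hT
  have hB : ∀ t ∈ Icc s T, ∀ i j, |C a l zc t i j| ≤ M * max T 1 := by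
    intro t ht i j
    have hb := hcoef t ⟨hs.trans_le ht.1, ht.2⟩
    by_cases hi : i = 4
    · subst hi
      exact (hb.2.1 j).trans (le_mul_of_one_le_right hM.le (le_max_right _ _))
    · exact (hb.1 i j hi).trans (mul_le_mul_of_nonneg_left (ht.2.trans (le_max_left _ _)) hM.le)
  have key := hu.isTransportSolution.eq_zero_of_lt_abs (R := max R₁ R₂)
    (K := 10 * (M * max T 1) / s) hs hlam
    (fun t ht i => hspeed t ht i) ?_ ?_
  · refine ⟨max R₁ R₂ + lam * (T - s), fun t ht p hp => key t ht p (lt_of_le_of_lt ?_ hp)⟩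
    have := mul_le_mul_of_nonneg_left (by linarith [ht.1] : T - t ≤ T - s) hlam.le
    linarith
  · intro t ht p hp
    have ht0 : 0 < t := hs.trans_le ht.1
    have hgp : g p = 0 := hR₂ p ((le_max_right _ _).trans hp.le)
    have h1 := sum_mul_mulVec_le (hB t ht) (u t p)
    have h2 : ∑ i, 2 * u t p i * systemRhs a l zc (fun t p => g p • source a zc t) u t p i
        = -(2 / t) * ∑ i, u t p i * (C a l zc t *ᵥ u t p) i := by
      rw [Finset.mul_sum]
      refine Finset.sum_congr rfl fun i _ => ?_
      simp only [systemRhs, hgp, zero_smul, Pi.zero_apply, add_zero]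
      ring
    rw [h2]
    have h3 := mul_le_mul_of_nonneg_left h1 (by positivity : 0 ≤ 2 / t)
    have h4 : 2 / t ≤ 2 / s := div_le_div_of_nonneg_left (by norm_num) hs ht.1
    have h5 : 0 ≤ 5 * (M * max T 1) * ∑ i, u t p i ^ 2 := by positivity
    have h6 := mul_le_mul_of_nonneg_right h4 h5
    have h7 : -(10 * (M * max T 1) / s) * ∑ i, u t p i ^ 2
        = -(2 / s * (5 * (M * max T 1) * ∑ i, u t p i ^ 2)) := by ring
    linarith
  · intro p hp
    rw [hu.initial]
    exact hR₁ p ((le_max_left _ _).trans hp.le)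

theorem sourceBound_of_source {M t : ℝ} (h1 : ∀ i, i ≠ 4 → |source a zc t i| ≤ M * t)
    (h2 : |source a zc t 4| ≤ M) :
    SourceBound M (fun t p => g p • source a zc t) (fun p => |g p|) t := by
  refine fun p => ⟨fun i hi => ?_, ?_⟩
  · simp only [Pi.smul_apply, smul_eq_mul]
    rw [abs_mul, mul_comm]
    exact mul_le_mul_of_nonneg_right (h1 i hi) (abs_nonneg _)
  · simp only [Pi.smul_apply, smul_eq_mul]
    rw [abs_mul, mul_comm]
    exact mul_le_mul_of_nonneg_right h2 (abs_nonneg _)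

end Solutions

/-! ### Comparison of the two energies -/

section Comparison

variable {c t T : ℝ} {u v : ℝ → ℝ → Fin 5 → ℝ}

theorem CoefficientBound.mono {M M' : ℝ} {B : Matrix (Fin 5) (Fin 5) ℝ} (ht : 0 ≤ t)
    (h : CoefficientBound M B t) (hM : M ≤ M') : CoefficientBound M' B t :=
  ⟨fun i j hi => (h.1 i j hi).trans (mul_le_mul_of_nonneg_right hM ht),
    fun j => (h.2 j).trans hM⟩

theorem IsTransportSolution.mono {α : ℝ → Fin 5 → ℝ} {N : ℝ → ℝ → Fin 5 → ℝ} {T' : ℝ}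
    (h : IsTransportSolution α N T v) (hT : T' ≤ T) : IsTransportSolution α N T' v where
  smooth i := (h.smooth i).mono (prod_mono (Ioc_subset_Ioc_right hT) le_rfl)
  equation t ht := h.equation t ⟨ht.1, ht.2.trans_le hT⟩

theorem HasLocallyUniformSupport.mono {T' : ℝ} (h : HasLocallyUniformSupport T v) (hT : T' ≤ T) :
    HasLocallyUniformSupport T' v := fun s hs =>
  let ⟨R, hR⟩ := h s hs
  ⟨R, fun t ht => hR t ⟨ht.1, ht.2.trans hT⟩⟩

theorem integrable_of_continuous_of_eq_zero {φ : ℝ → ℝ} (hφ : Continuous φ)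
    (hR : ∃ R, ∀ p, R < |p| → φ p = 0) : Integrable φ := by
  obtain ⟨R, hR⟩ := hR
  refine hφ.integrable_of_hasCompactSupport
    (HasCompactSupport.intro (isCompact_Icc (a := -R) (b := R)) fun p hp => hR p ?_)
  by_contra! h
  exact hp (abs_le.1 h)

theorem integrable_energy (hcont : ∀ i, Continuous fun p => v t p i)
    (hR : ∃ R, ∀ p, R < |p| → v t p = 0) :
    Integrable fun p => ∑ i, energyWeight c i (t, p) * v t p i ^ 2 := by
  refine integrable_of_continuous_of_eq_zero (continuous_finsetSum _ fun i _ => ?_) ?_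
  · have : Continuous fun p : ℝ => energyWeight c i (t, p) := by
      simp only [energyWeight]
      exact continuous_const
    exact this.mul ((hcont i).pow 2)
  · obtain ⟨R, hR⟩ := hR
    exact ⟨R, fun p hp => by simp [hR p hp]⟩

theorem rpow_two_mul (ht : 0 < t) : t ^ (2 * c) = t ^ c * t ^ c := by
  rw [← Real.rpow_add ht]
  ring_nf

theorem E₁_eq (ht : 0 < t) : E₁ c u t = t ^ (2 * c) * ∫ p, ∑ i, u t p i ^ 2 := by
  rw [← integral_const_mul]
  refine integral_congr_ae (ae_of_all _ fun p => ?_)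
  simp only [x, dotProduct, Pi.smul_apply, smul_eq_mul, Finset.mul_sum, rpow_two_mul ht]
  exact Finset.sum_congr rfl fun i _ => by ring

theorem E₁_nonneg (ht : 0 < t) : 0 ≤ E₁ c u t := by
  rw [E₁_eq ht]
  exact mul_nonneg (by positivity)
    (integral_nonneg fun p => Finset.sum_nonneg fun i _ => sq_nonneg _)

theorem E₂pos_eq (ht : 0 < t) : E₂pos c u t = energy c u t := by
  refine integral_congr_ae (ae_of_all _ fun p => ?_)
  simp only
  rw [sum_energyWeight ht, rpow_two_mul ht]
  simp only [x, dotProduct, Pi.smul_apply, smul_eq_mul, Fin.sum_univ_five]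
  ring

theorem E₂_eq (ht : 0 < t) : E₂ c u t = energy c u t := by
  rw [E₂, if_neg ht.ne', E₂pos_eq ht]

theorem integrable_sum_sq (hcont : ∀ i, Continuous fun p => u t p i)
    (hR : ∃ R, ∀ p, R < |p| → u t p = 0) : Integrable fun p => ∑ i, u t p i ^ 2 := by
  refine integrable_of_continuous_of_eq_zero
    (continuous_finsetSum _ fun i _ => (hcont i).pow 2) ?_
  obtain ⟨R, hR⟩ := hR
  exact ⟨R, fun p hp => by simp [hR p hp]⟩

theorem energy_le_E₁ (ht : 0 < t) (hcont : ∀ i, Continuous fun p => u t p i)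
    (hR : ∃ R, ∀ p, R < |p| → u t p = 0) : energy c u t ≤ max 1 t * E₁ c u t := by
  rw [E₁_eq ht, ← integral_const_mul, ← integral_const_mul]
  refine integral_mono (integrable_energy hcont hR)
    (((integrable_sum_sq hcont hR).const_mul _).const_mul _) fun p => ?_
  simp only
  rw [sum_energyWeight ht, mul_left_comm, Fin.sum_univ_five]
  refine mul_le_mul_of_nonneg_left ?_ (by positivity)
  have h1 := le_max_left 1 t
  have h2 := mul_le_mul_of_nonneg_right (le_max_right 1 t) (sq_nonneg (u t p 4))
  have h3 : 0 ≤ u t p 0 ^ 2 + u t p 1 ^ 2 + u t p 2 ^ 2 + u t p 3 ^ 2 := by positivity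
  nlinarith

/-- The energies differ only by the factor `t` on the fifth square, which costs exactly one power of
`t`. This is the source of the rate `μ / t` for `E₁`. -/
theorem mul_E₁_le_energy (ht : 0 < t) (ht1 : t ≤ 1) (hcont : ∀ i, Continuous fun p => u t p i)
    (hR : ∃ R, ∀ p, R < |p| → u t p = 0) : t * E₁ c u t ≤ energy c u t := by
  rw [E₁_eq ht, ← integral_const_mul, ← integral_const_mul]
  refine integral_mono (((integrable_sum_sq hcont hR).const_mul _).const_mul _)
    (integrable_energy hcont hR) fun p => ?_
  simp only
  rw [sum_energyWeight ht, mul_left_comm, Fin.sum_univ_five]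
  refine mul_le_mul_of_nonneg_left ?_ (by positivity)
  have h3 : 0 ≤ u t p 0 ^ 2 + u t p 1 ^ 2 + u t p 2 ^ 2 + u t p 3 ^ 2 := by positivity
  nlinarith

/-- The parallelogram bound. -/
theorem energy_le_of_abs_le {u v w : ℝ → ℝ → Fin 5 → ℝ} (ht : 0 < t)
    (huvw : ∀ p i, |u t p i| ≤ |v t p i| + |w t p i|)
    (hu : Integrable fun p => ∑ i, energyWeight c i (t, p) * u t p i ^ 2)
    (hv : Integrable fun p => ∑ i, energyWeight c i (t, p) * v t p i ^ 2)
    (hw : Integrable fun p => ∑ i, energyWeight c i (t, p) * w t p i ^ 2) :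
    energy c u t ≤ 2 * energy c v t + 2 * energy c w t := by
  unfold energy
  rw [← integral_const_mul, ← integral_const_mul, ← integral_add (hv.const_mul 2) (hw.const_mul 2)]
  refine integral_mono hu ((hv.const_mul 2).add (hw.const_mul 2)) fun p => ?_
  simp only [Finset.mul_sum, ← Finset.sum_add_distrib]
  refine Finset.sum_le_sum fun i _ => ?_
  have h1 : u t p i ^ 2 ≤ 2 * v t p i ^ 2 + 2 * w t p i ^ 2 := by
    have h := pow_le_pow_left₀ (abs_nonneg _) (huvw p i) 2
    rw [sq_abs] at h
    rw [← sq_abs (v t p i), ← sq_abs (w t p i)]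
    nlinarith [sq_nonneg (|v t p i| - |w t p i|)]
  have := mul_le_mul_of_nonneg_left h1 (energyWeight_nonneg (c := c) ht i p)
  linarith

theorem energyWeight_le (hc : 0 ≤ c) (ht : t ∈ Ioc 0 T) (i : Fin 5) (p : ℝ) :
    energyWeight c i (t, p) ≤ max T 1 ^ (2 * c + 1) := by
  have h1 : t ≤ max T 1 := ht.2.trans (le_max_left _ _)
  unfold energyWeight
  split_ifs
  · exact Real.rpow_le_rpow ht.1.le h1 (by linarith)
  · exact (Real.rpow_le_rpow ht.1.le h1 (by linarith)).trans
      (Real.rpow_le_rpow_of_exponent_le (le_max_right _ _) (by linarith))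

end Comparison

/-! ### Eliminating the velocity data through the Einstein constraint -/

section Constraint

variable {a zc c z T : ℝ} {l : ℕ} {f : ℝ → Fin 5 → ℝ} {g : ℝ → ℝ} {u : ℝ → ℝ → Fin 5 → ℝ}

/-- The source divided by the coefficient of the `p`-derivative. -/
noncomputable def corrector (a z : ℝ) : Fin 5 → ℝ :=
  let D := deriv (S a) z
  let S := S a z
  let q := q a z
  let π := Real.pi
  ![0, 0, 16 * π * q * (-S + z * D) / S, 8 * π * q * (1 + D) * (S - z * D) / S,
    -(8 * π * q * (-1 + D) * (S - z * D) / S)]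

/-- In the fifth component the source and the speed have the same pole `1/h_+`, so their quotient,
the corrector, stays smooth at the horizon. -/
theorem Atilde_mul_corrector (i : Fin 5) :
    Atilde a z i i * corrector a z i = sourceTilde a z i := by
  simp only [Atilde, Matrix.diagonal_apply_eq]
  fin_cases i <;> simp [corrector, sourceTilde, div_eq_mul_inv] <;> ring

theorem contDiffOn_corrector (i : Fin 5) :
    ContDiffOn ℝ ∞ (fun z => corrector a z i) (regularSet a) := by
  have cS := contDiffOn_S (a := a)
  have cD : ContDiffOn ℝ ∞ (deriv (S a)) (regularSet a) := by
    simpa using contDiffOn_iteratedDeriv_S (a := a) 1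
  have cq := contDiffOn_q (a := a)
  have nS : ∀ z ∈ regularSet a, S a z ≠ 0 := fun z hz => (S_pos hz).ne'
  fin_cases i <;> simp [corrector] <;> fun_prop (disch := assumption)

/-- The correction which removes a spatial derivative of the third component of the data from the
source. -/
noncomputable def correction (a zc β : ℝ) (f : ℝ → Fin 5 → ℝ) (t p : ℝ) (i : Fin 5) : ℝ :=
  β * (corrector a (zc + t) i * f p 2)

noncomputable def corrected (a zc β : ℝ) (f : ℝ → Fin 5 → ℝ) (u : ℝ → ℝ → Fin 5 → ℝ) (t p : ℝ)
    (i : Fin 5) : ℝ := u t p i - correction a zc β f t p i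

/-- The first term is the source with `β f_3'` removed. The second is the price of the correction:
the zeroth-order matrix and the `z`-derivative acting on the corrector, with no derivative of the
data. -/
noncomputable def correctedSource (a : ℝ) (l : ℕ) (zc β : ℝ) (f : ℝ → Fin 5 → ℝ) (g : ℝ → ℝ)
    (t p : ℝ) (i : Fin 5) : ℝ :=
  (g p - β * deriv (fun s => f s 2) p) * source a zc t i
    - β * f p 2 * ((C a l zc t *ᵥ corrector a (zc + t)) i
      + t * deriv (fun z => corrector a z i) (zc + t))

theorem IsSolution.isTransportSolution_corrected (ha : 0 < a) (hzc : IsCauchyHorizon a zc)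
    (hf : IsTest f) (hu : IsSolution a l zc T f g u) (β : ℝ) :
    IsTransportSolution (speed a zc)
      (systemRhs a l zc (correctedSource a l zc β f g) (corrected a zc β f u)) T
      (corrected a zc β f u) := by
  have hU := hu.isTransportSolution
  have hf2 : ContDiff ℝ ∞ fun s => f s 2 := contDiff_pi.1 hf.1 2
  refine ⟨fun i => (hU.smooth i).sub (contDiffOn_const.mul (ContDiffOn.mul ?_ ?_)),
    fun t ht p i => ?_⟩
  · refine ((contDiffOn_corrector i).of_le (by exact_mod_cast le_top)).comp
      (f := fun y : ℝ × ℝ => zc + y.1) (by fun_prop) fun y hy => ?_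
    exact hzc.mem_regularSet ha (by linarith [hy.1.1])
  · exact ((hf2.of_le (by exact_mod_cast le_top)).comp contDiff_snd).contDiffOn
  · have hmem : zc + t ∈ regularSet a := hzc.mem_regularSet ha (by linarith [ht.1])
    have hnhds : Ioc 0 T ×ˢ (univ : Set ℝ) ∈ 𝓝 (t, p) :=
      prod_mem_nhds (Ioc_mem_nhds ht.1 ht.2) univ_mem
    have h1 := (((hU.smooth i).contDiffAt hnhds).differentiableAt one_ne_zero).hasFDerivAt
    have h2 : HasDerivAt (fun z => corrector a z i) (deriv (fun z => corrector a z i) (zc + t))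
        (zc + t) := (((contDiffOn_corrector i).contDiffAt
          (isOpen_regularSet.mem_nhds hmem)).differentiableAt (by simp)).hasDerivAt
    have h3 : HasDerivAt (fun s => f s 2) (deriv (fun s => f s 2) p) p :=
      (hf2.differentiable (by simp) p).hasDerivAt
    have hfst : HasFDerivAt (fun y : ℝ × ℝ => zc + y.1) (ContinuousLinearMap.fst ℝ ℝ ℝ) (t, p) :=
      (ContinuousLinearMap.fst ℝ ℝ ℝ).hasFDerivAt.const_add zc
    have h2' := h2.comp_hasFDerivAt (f := fun y : ℝ × ℝ => zc + y.1) (t, p) hfst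
    have h3' := h3.comp_hasFDerivAt (f := fun y : ℝ × ℝ => y.2) (t, p)
      (ContinuousLinearMap.snd ℝ ℝ ℝ).hasFDerivAt
    have h4 := h1.fun_sub ((h2'.fun_mul h3').const_mul β)
    have h5 : fderiv ℝ (fun y : ℝ × ℝ => corrected a zc β f u y.1 y.2 i) (t, p) = _ := h4.fderiv
    rw [h5]
    have hA : speed a zc t i * corrector a (zc + t) i = sourceTilde a (zc + t) i :=
      Atilde_mul_corrector i
    have hCv : (C a l zc t *ᵥ corrected a zc β f u t p) i
        = (C a l zc t *ᵥ u t p) i - β * f p 2 * (C a l zc t *ᵥ corrector a (zc + t)) i := by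
      rw [show corrected a zc β f u t p = u t p - (β * f p 2) • corrector a (zc + t) by
        ext j
        simp only [corrected, correction, Pi.sub_apply, Pi.smul_apply, smul_eq_mul]
        ring, Matrix.mulVec_sub, Matrix.mulVec_smul]
      rfl
    simp only [sub_apply, smul_apply,
      add_apply, ContinuousLinearMap.coe_fst', ContinuousLinearMap.coe_snd',
      hU.equation t ht p i, Function.comp_apply, smul_eq_mul]
    simp only [systemRhs, hCv, correctedSource, source, Pi.smul_apply, smul_eq_mul, ← hA]
    have := ht.1.ne'
    field_simp
    ring

theorem IsCauchyHorizon.exists_corrector_bound (ha : 0 < a) (hzc : IsCauchyHorizon a zc)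
    (hT : zc + T < 0) : ∃ K > 0, ∀ t ∈ Ioc 0 T, ∀ i,
      |corrector a (zc + t) i| ≤ K ∧ |deriv (fun z => corrector a z i) (zc + t)| ≤ K := by
  have h1 : ∀ i, ∃ K, ∀ t ∈ Ioc 0 T, |corrector a (zc + t) i| ≤ K := fun i =>
    exists_abs_le_of_continuousAt (f := fun z => corrector a z i) (fun z hz _ =>
      (contDiffOn_corrector i).continuousOn.continuousAt
        (isOpen_regularSet.mem_nhds (hzc.mem_regularSet ha hz))) hT
  have h2 : ∀ i, ∃ K, ∀ t ∈ Ioc 0 T, |deriv (fun z => corrector a z i) (zc + t)| ≤ K := fun i =>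
    exists_abs_le_of_continuousAt (fun z hz _ =>
      ((contDiffOn_corrector i).deriv_of_isOpen (m := ∞) isOpen_regularSet
        le_rfl).continuousOn.continuousAt
        (isOpen_regularSet.mem_nhds (hzc.mem_regularSet ha hz))) hT
  choose K₁ hK₁ using h1
  choose K₂ hK₂ using h2
  obtain ⟨K, hK⟩ := Finite.bddAbove_range (Sum.elim K₁ K₂)
  refine ⟨max K 1, by positivity, fun t ht i => ⟨?_, ?_⟩⟩
  · exact (hK₁ i t ht).trans ((hK ⟨Sum.inl i, rfl⟩).trans (le_max_left _ _))
  · exact (hK₂ i t ht).trans ((hK ⟨Sum.inr i, rfl⟩).trans (le_max_left _ _))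

/-- On constrained data the velocity data are, up to a multiple of the derivative of the third
component, bounded pointwise by the data. -/
theorem IsCauchyHorizon.exists_constraint_bound (ha : 0 < a) (hzc : IsCauchyHorizon a zc) (l : ℕ)
    (hz : zc < z) (hz0 : z < 0) : ∃ β, ∃ P ≥ 0, ∀ (f : ℝ → Fin 5 → ℝ) (g : ℝ → ℝ),
      EinsteinConstraint a l z f g →
      ∀ p, |g p - β * deriv (fun s => f s 2) p| ≤ P * ∑ i, |f p i| := by
  have hmem := hzc.mem_regularSet ha hz.le
  have hg7 : 0 < constraintCoeffSource a z := by
    have h1 := S_pos hmem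
    -- Positive density makes the coefficient of `g` nonzero, which allows the constraint to be
    -- solved for `g`.
    have h2 := q_pos ha hmem
    have h3 := hzc.w_pos ha hz.le hz0.le
    unfold constraintCoeffSource
    positivity
  refine ⟨-(constraintCoeffDeriv a z / constraintCoeffSource a z),
    (∑ i, |constraintCoeff a l z i|) / constraintCoeffSource a z, by positivity, ?_⟩
  intro f g hc p
  have h := hc p
  have h1 : g p - -(constraintCoeffDeriv a z / constraintCoeffSource a z)
      * deriv (fun s => f s 2) p
      = -(constraintCoeff a l z ⬝ᵥ f p) / constraintCoeffSource a z := by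
    field_simp
    linarith
  rw [h1, abs_div, abs_neg, abs_of_pos hg7, div_mul_eq_mul_div]
  refine div_le_div_of_nonneg_right ?_ hg7.le
  refine (Finset.abs_sum_le_sum_abs _ _).trans ?_
  rw [Finset.sum_mul]
  refine Finset.sum_le_sum fun i _ => ?_
  rw [abs_mul]
  exact mul_le_mul_of_nonneg_left
    (Finset.single_le_sum (f := fun i => |f p i|) (fun j _ => abs_nonneg _) (Finset.mem_univ i))
    (abs_nonneg _)

/-- The new source has the same structure as the old one, since both `C` applied to the corrector
and `t` times its derivative are `O(t)` in the first four components and bounded in the fifth. The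
energy estimate thus applies with `Σ |f_i|` in place of `|g|`. -/
theorem sourceBound_correctedSource {M K P β t : ℝ} (ht : t ∈ Ioc 0 T) (hM : 0 ≤ M) (hK : 0 ≤ K)
    (hP : 0 ≤ P) (hB : CoefficientBound M (C a l zc t) t)
    (h1 : ∀ i, i ≠ 4 → |source a zc t i| ≤ M * t) (h2 : |source a zc t 4| ≤ M)
    (hκ : ∀ i, |corrector a (zc + t) i| ≤ K ∧ |deriv (fun z => corrector a z i) (zc + t)| ≤ K)
    (hg : ∀ p, |g p - β * deriv (fun s => f s 2) p| ≤ P * ∑ i, |f p i|) :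
    SourceBound (P * M + |β| * (K * (5 * M + 1 + T))) (correctedSource a l zc β f g)
      (fun p => ∑ i, |f p i|) t := by
  intro p
  have hγ : 0 ≤ ∑ i, |f p i| := Finset.sum_nonneg fun i _ => abs_nonneg _
  have hf2 : |f p 2| ≤ ∑ i, |f p i| :=
    Finset.single_le_sum (f := fun i => |f p i|) (fun j _ => abs_nonneg _) (Finset.mem_univ 2)
  obtain ⟨c1, c2⟩ := hB.abs_mulVec_le (corrector a (zc + t))
  have hκ' := fun i => (hκ i).1
  have ht0 := ht.1.le
  have gen : ∀ (i : Fin 5) (A B : ℝ), 0 ≤ A → |source a zc t i| ≤ A →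
      |(C a l zc t *ᵥ corrector a (zc + t)) i
        + t * deriv (fun z => corrector a z i) (zc + t)| ≤ B →
      |correctedSource a l zc β f g t p i| ≤ (P * A + |β| * B) * ∑ i, |f p i| := by
    intro i A B hA hs hc
    have hB0 : 0 ≤ B := (abs_nonneg _).trans hc
    calc |correctedSource a l zc β f g t p i|
        ≤ |(g p - β * deriv (fun s => f s 2) p) * source a zc t i|
          + |β * f p 2 * ((C a l zc t *ᵥ corrector a (zc + t)) i
            + t * deriv (fun z => corrector a z i) (zc + t))| := abs_sub _ _
      _ ≤ (P * ∑ i, |f p i|) * A + |β| * (∑ i, |f p i|) * B := by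
        rw [abs_mul, abs_mul (β * f p 2), abs_mul β]
        refine add_le_add (mul_le_mul (hg p) hs (abs_nonneg _) (by positivity))
          (mul_le_mul (mul_le_mul_of_nonneg_left hf2 (abs_nonneg _)) hc (abs_nonneg _)
            (by positivity))
      _ = _ := by ring
  have hd : ∀ i, |t * deriv (fun z => corrector a z i) (zc + t)| ≤ t * K := fun i => by
    rw [abs_mul, abs_of_pos ht.1]
    exact mul_le_mul_of_nonneg_left (hκ i).2 ht0
  constructor
  · intro i hi
    refine (gen i (M * t) (M * t * (5 * K) + t * K) (by positivity) (h1 i hi) ?_).trans ?_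
    · refine (abs_add_le _ _).trans (add_le_add ((c1 i hi).trans ?_) (hd i))
      exact mul_le_mul_of_nonneg_left
        (by linarith [hκ' 0, hκ' 1, hκ' 2, hκ' 3, hκ' 4]) (by positivity)
    · refine mul_le_mul_of_nonneg_right ?_ hγ
      have : 0 ≤ |β| * (K * T) * t := by
        have := ht.1.trans_le ht.2
        positivity
      linarith
  · refine (gen 4 M (M * (5 * K) + T * K) hM h2 ?_).trans ?_
    · have h3 : |C a l zc t 4 4 * corrector a (zc + t) 4| ≤ M * K := by
        rw [abs_mul]
        exact mul_le_mul (hB.2 4) (hκ' 4) (abs_nonneg _) hM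
      have h4 := mul_le_mul_of_nonneg_left
        (by linarith [hκ' 0, hκ' 1, hκ' 2, hκ' 3] : |corrector a (zc + t) 0|
          + |corrector a (zc + t) 1| + |corrector a (zc + t) 2| + |corrector a (zc + t) 3| ≤ 4 * K)
        hM
      have h5 := abs_le.1 h3
      have h6 := abs_le.1 (c2.trans h4)
      have h7 := abs_le.1 ((hd 4).trans (mul_le_mul_of_nonneg_right ht.2 hK))
      rw [abs_le]
      constructor <;> linarith
    · refine mul_le_mul_of_nonneg_right ?_ hγ
      have : 0 ≤ |β| * K := by positivity
      linarith

/-- On constrained data the second energy is bounded by the initial energy alone. -/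
theorem IsCauchyHorizon.exists_energy_bound_of_constraint (ha : 0 < a)
    (hzc : IsCauchyHorizon a zc) (hc : IsExponent a l zc c) (hT0 : 0 < T) (hT : zc + T < 0) :
    ∃ ν > 0, ∀ (f : ℝ → Fin 5 → ℝ) (g : ℝ → ℝ), IsTest f → IsTest g →
      ∀ u : ℝ → ℝ → Fin 5 → ℝ, IsSolution a l zc T f g u →
      EinsteinConstraint a l (zc + T) f g → ∀ t ∈ Ioc 0 T, energy c u t ≤ ν * E₁ c u T := by
  obtain ⟨hc2, -⟩ := hzc.tendsto_div_hPlus ha hc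
  obtain ⟨M, hM, hcoef⟩ := hzc.exists_coefficient_bound ha hc hT
  obtain ⟨K, hK, hκ⟩ := hzc.exists_corrector_bound ha hT
  obtain ⟨β, P, hP, hconstr⟩ := hzc.exists_constraint_bound ha l
    (by linarith : zc < zc + T) hT
  set M' := P * M + |β| * (K * (5 * M + 1 + T)) with hM'
  have hM'0 : 0 ≤ M' := by positivity
  obtain ⟨ν, hν, hbound⟩ := hzc.exists_energy_bound ha hc (M := max M M') (by positivity) hT0
    fun t ht => CoefficientBound.mono ht.1.le
      ⟨(hcoef t ht).1, (hcoef t ht).2.1⟩ (le_max_left M M')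
  -- `Kω` bounds the energy of the correction by `∫ (Σ |f_i|)²`. Below, `k` bounds that integral by
  -- `E₁` at time `T`, with 5 from Cauchy-Schwarz, and `m` compares the two energies at `T`.
  set Kω := 5 * (max T 1 ^ (2 * c + 1) * (|β| * K) ^ 2) with hKω
  have hKω0 : 0 ≤ Kω := by positivity
  set m := max 1 T with hm
  have hm0 : 0 < m := by positivity
  set k := 5 * (T ^ (2 * c))⁻¹ with hk
  have hk0 : 0 ≤ k := by positivity
  -- The parallelogram bound is used twice: at `T` to pass from `u` to the corrected field, and at
  -- `t` to return.
  refine ⟨2 * (ν * (2 * m + 2 * (Kω * k) + k)) + 2 * (Kω * k), by positivity, ?_⟩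
  intro f g hf hg u hu hE t ht
  have hTT : T ∈ Ioc 0 T := ⟨hT0, le_rfl⟩
  have hsupp := hu.hasLocallyUniformSupport ha hzc hc hT hf hg
  have hV := hu.isTransportSolution_corrected ha hzc hf β
  obtain ⟨R, -, hR⟩ := hf.2.exists_pos_le_norm
  have hω0 : ∀ t p, R < |p| → correction a zc β f t p = 0 := fun t p hp => by
    ext i
    simp [correction, hR p hp.le]
  have hsuppv : HasLocallyUniformSupport T (corrected a zc β f u) := by
    intro s hs
    obtain ⟨R', hR'⟩ := hsupp s hs
    refine ⟨max R R', fun τ hτ p hp => ?_⟩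
    ext i
    have h1 := congrFun (hR' τ hτ p ((le_max_right _ _).trans_lt hp)) i
    have h2 := congrFun (hω0 τ p ((le_max_left _ _).trans_lt hp)) i
    simp only [corrected, h1, h2]
    simp
  have hfcont : ∀ i, Continuous fun p => f p i := fun i =>
    (contDiff_pi.1 hf.1 i).continuous
  set γ : ℝ → ℝ := fun p => ∑ i, |f p i| with hγ
  have hγint : Integrable fun p => γ p ^ 2 := by
    refine integrable_of_continuous_of_eq_zero
      ((continuous_finsetSum _ fun i _ => (hfcont i).abs).pow 2) ⟨R, fun p hp => ?_⟩
    simp [hγ, hR p hp.le]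
  have hslice : ∀ τ ∈ Ioc 0 T, ∃ R, ∀ p, R < |p| → u τ p = 0 := fun τ hτ =>
    let ⟨R, hR⟩ := hsupp τ hτ.1
    ⟨R, fun p hp => hR τ ⟨le_rfl, hτ.2⟩ p hp⟩
  have hslicev : ∀ τ ∈ Ioc 0 T, ∃ R, ∀ p, R < |p| → corrected a zc β f u τ p = 0 := fun τ hτ =>
    let ⟨R, hR⟩ := hsuppv τ hτ.1
    ⟨R, fun p hp => hR τ ⟨le_rfl, hτ.2⟩ p hp⟩
  have iu := fun τ (hτ : τ ∈ Ioc 0 T) => integrable_energy (c := c)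
    (hu.isTransportSolution.continuous_slice hτ) (hslice τ hτ)
  have iv := fun τ (hτ : τ ∈ Ioc 0 T) => integrable_energy (c := c)
    (hV.continuous_slice hτ) (hslicev τ hτ)
  have iω := fun τ => integrable_energy (c := c) (t := τ) (v := correction a zc β f)
    (fun i => continuous_const.mul (continuous_const.mul (hfcont 2))) ⟨R, hω0 τ⟩
  have hω : ∀ τ ∈ Ioc 0 T, energy c (correction a zc β f) τ ≤ Kω * ∫ p, γ p ^ 2 := by
    intro τ hτ
    unfold energy
    rw [← integral_const_mul]
    refine integral_mono (iω τ) (hγint.const_mul _) fun p => ?_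
    have hi : ∀ i ∈ Finset.univ, energyWeight c i (τ, p) * correction a zc β f τ p i ^ 2
        ≤ max T 1 ^ (2 * c + 1) * (|β| * K) ^ 2 * γ p ^ 2 := by
      intro i _
      rw [mul_assoc]
      refine mul_le_mul (energyWeight_le (by linarith) hτ i p) ?_ (sq_nonneg _) (by positivity)
      rw [← mul_pow, ← sq_abs]
      refine pow_le_pow_left₀ (abs_nonneg _) ?_ 2
      rw [correction, abs_mul, abs_mul, mul_assoc]
      refine mul_le_mul_of_nonneg_left (mul_le_mul (hκ τ hτ i).1 ?_ (abs_nonneg _) hK.le)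
        (abs_nonneg _)
      exact Finset.single_le_sum (f := fun i => |f p i|) (fun j _ => abs_nonneg _)
        (Finset.mem_univ 2)
    refine (Finset.sum_le_card_nsmul _ _ _ hi).trans (le_of_eq ?_)
    simp only [Finset.card_univ, Fintype.card_fin, nsmul_eq_mul, hKω]
    push_cast
    ring
  have hΓ : ∫ p, γ p ^ 2 ≤ k * E₁ c u T := by
    rw [E₁_eq hT0, hu.initial, hk, mul_assoc, inv_mul_cancel_left₀ (by positivity),
      ← integral_const_mul]
    refine integral_mono hγint
      ((integrable_sum_sq (t := T) (u := fun _ => f) hfcont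
        ⟨R, fun p hp => hR p hp.le⟩).const_mul 5) fun p => ?_
    have := sq_sum_le_card_mul_sum_sq (s := Finset.univ) (f := fun i => |f p i|)
    simpa [sq_abs] using this
  have hEv := hbound _ _ γ hV hsuppv hγint (fun τ hτ => ?_) t ht
  · have e1 := energy_le_of_abs_le (c := c) ht.1 (u := u) (v := corrected a zc β f u)
      (w := correction a zc β f) (fun p i => by
        have := abs_add_le (corrected a zc β f u t p i) (correction a zc β f t p i)
        rwa [corrected, sub_add_cancel] at this) (iu t ht) (iv t ht) (iω t)
    have e2 := energy_le_of_abs_le (c := c) hT0 (u := corrected a zc β f u) (v := u)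
      (w := correction a zc β f) (fun p i => abs_sub _ _) (iv T hTT) (iu T hTT) (iω T)
    have e3 := energy_le_E₁ (c := c) hT0 (hu.isTransportSolution.continuous_slice hTT)
      (hslice T hTT)
    have e4 := hω t ht
    have e5 := hω T hTT
    have e6 := mul_le_mul_of_nonneg_left hΓ hKω0
    have e7 : energy c (corrected a zc β f u) T + ∫ p, γ p ^ 2
        ≤ (2 * m + 2 * (Kω * k) + k) * E₁ c u T := by linarith
    have e8 := mul_le_mul_of_nonneg_left e7 hν.le
    linarith
  · have hs := sourceBound_correctedSource (β := β) hτ hM.le hK.le hP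
      ⟨(hcoef τ hτ).1, (hcoef τ hτ).2.1⟩ (hcoef τ hτ).2.2.1 (hcoef τ hτ).2.2.2 (hκ τ hτ)
      (hconstr f g hE)
    intro p
    have hγp : 0 ≤ γ p := Finset.sum_nonneg fun i _ => abs_nonneg _
    refine ⟨fun i hi => ((hs p).1 i hi).trans ?_, (hs p).2.trans ?_⟩
    · exact mul_le_mul_of_nonneg_right
        (mul_le_mul_of_nonneg_right (le_max_right _ _) hτ.1.le) hγp
    · exact mul_le_mul_of_nonneg_right (le_max_right _ _) hγp

end Constraint

/-! ### Behaviour up to the horizon and conclusion -/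

section Main

variable {a zc c T : ℝ} {l : ℕ} {f : ℝ → Fin 5 → ℝ} {g : ℝ → ℝ} {u : ℝ → ℝ → Fin 5 → ℝ}

theorem IsTest.integrable_sq (hg : IsTest g) : Integrable fun p => g p ^ 2 := by
  obtain ⟨R, -, hR⟩ := hg.2.exists_pos_le_norm
  exact integrable_of_continuous_of_eq_zero (hg.1.continuous.pow 2)
    ⟨R, fun p hp => by simp [hR p hp.le]⟩

theorem IsSolution.exists_slice_support (ha : 0 < a) (hzc : IsCauchyHorizon a zc)
    (hc : IsExponent a l zc c) (hT : zc + T < 0) (hf : IsTest f) (hg : IsTest g)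
    (hu : IsSolution a l zc T f g u) {t : ℝ} (ht : t ∈ Ioc 0 T) :
    ∃ R, ∀ p, R < |p| → u t p = 0 :=
  let ⟨R, hR⟩ := hu.hasLocallyUniformSupport ha hzc hc hT hf hg t ht.1
  ⟨R, fun p hp => hR t ⟨le_rfl, ht.2⟩ p hp⟩

variable (ha : 0 < a) (hzc : IsCauchyHorizon a zc) (hc : IsExponent a l zc c)
include ha hzc hc

/-- Near monotonicity of the second energy, with constants depending on the background only. -/
theorem IsCauchyHorizon.exists_energy_near_solution :
    ∃ δ > 0, ∃ k > 0, ∀ T, 0 < T → zc + T < 0 → ∀ (f : ℝ → Fin 5 → ℝ) (g : ℝ → ℝ), IsTest f →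
      IsTest g → ∀ u : ℝ → ℝ → Fin 5 → ℝ, IsSolution a l zc T f g u →
      ∀ s t, 0 < s → s ≤ t → t ≤ min δ T →
        energy c u s ≤ energy c u t + k * t * (t - s) * ∫ p, g p ^ 2 := by
  have hneg := hzc.neg
  -- The coefficients are bounded on the fixed interval ending at `-zc / 2`, rather than on `(0,
  -- T]`, so that the constants depend on the background alone; some entries have a pole at `z = 0`.
  obtain ⟨M, hM, hcoef⟩ := hzc.exists_coefficient_bound ha hc (T := -zc / 2) (by linarith)
  obtain ⟨δ, hδ, k, hk, hnear⟩ := hzc.exists_energy_near ha hc M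
  refine ⟨min δ (-zc / 2), lt_min hδ (by linarith), k, hk, ?_⟩
  intro T hT0 hT f g hf hg u hu s t hs hst ht
  have hmin : min T (-zc / 2) ≤ T := min_le_left _ _
  have h := hnear (min T (-zc / 2)) _ u (fun p => |g p|) (hu.isTransportSolution.mono hmin)
    ((hu.hasLocallyUniformSupport ha hzc hc hT hf hg).mono hmin)
    (by simpa only [sq_abs] using hg.integrable_sq) (fun τ hτ => ?_) s t hs hst ?_
  · simpa only [sq_abs] using h
  · have hτ' := hcoef τ ⟨hτ.1, hτ.2.trans ((min_le_right _ _).trans (min_le_right _ _))⟩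
    exact ⟨⟨hτ'.1, hτ'.2.1⟩, sourceBound_of_source hτ'.2.2.1 hτ'.2.2.2⟩
  · have h1 := ht.trans (min_le_left _ _)
    exact le_min (h1.trans (min_le_left _ _))
      (le_min (ht.trans (min_le_right _ _)) (h1.trans (min_le_right _ _)))

/-- Adding a linear function of `t` that dominates the source loss makes the energy monotone near 0.
Being bounded below, the sum has a limit, and the linear term tends to 0. -/
theorem IsSolution.tendsto_energy (hT0 : 0 < T) (hT : zc + T < 0) (hf : IsTest f) (hg : IsTest g)
    (hu : IsSolution a l zc T f g u) : Tendsto (energy c u) (𝓝[>] 0) (𝓝 (E₂ c u 0)) := by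
  obtain ⟨δ, hδ, k, hk, hnear⟩ := hzc.exists_energy_near_solution ha hc
  set r := min δ T
  have hr : 0 < r := lt_min hδ hT0
  set Γ := ∫ p, g p ^ 2 with hΓ
  have hΓ0 : 0 ≤ Γ := integral_nonneg fun p => sq_nonneg _
  have hmono : MonotoneOn (fun t => energy c u t + k * r * t * Γ) (Ioo 0 r) := by
    intro s hs t ht hst
    have h1 := hnear T hT0 hT f g hf hg u hu s t hs.1 hst ht.2.le
    have h2 : k * t * (t - s) * Γ ≤ k * r * (t - s) * Γ :=
      mul_le_mul_of_nonneg_right (mul_le_mul_of_nonneg_right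
        (mul_le_mul_of_nonneg_left ht.2.le hk.le) (by linarith)) hΓ0
    simp only
    linarith
  have hlim := hmono.tendsto_nhdsWithin_Ioo_right (nonempty_Ioo.2 hr) ⟨0, by
    rintro _ ⟨t, ht, rfl⟩
    have := energy_nonneg (c := c) ht.1 u
    have := ht.1.le
    positivity⟩
  have hlin : Tendsto (fun t : ℝ => k * r * t * Γ) (𝓝[>] 0) (𝓝 0) := by
    have : Tendsto (fun t : ℝ => k * r * t * Γ) (𝓝 0) (𝓝 (k * r * 0 * Γ)) :=
      Continuous.tendsto (by fun_prop) 0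
    simpa using this.mono_left nhdsWithin_le_nhds
  have h := hlim.sub hlin
  simp only [add_sub_cancel_right, sub_zero] at h
  have h' : Tendsto (E₂pos c u) (𝓝[>] 0) (𝓝 _) := h.congr' (by
    filter_upwards [self_mem_nhdsWithin] with t ht using (E₂pos_eq ht).symm)
  rw [E₂, if_pos rfl, h'.limUnder_eq]
  exact h

theorem IsSolution.continuousOn_E₂ (hT0 : 0 < T) (hT : zc + T < 0) (hf : IsTest f)
    (hg : IsTest g) (hu : IsSolution a l zc T f g u) : ContinuousOn (E₂ c u) (Icc 0 T) := by
  intro t ht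
  rcases eq_or_lt_of_le ht.1 with rfl | h0
  · have h : ContinuousWithinAt (E₂ c u) (Ioi 0) 0 :=
      (hu.tendsto_energy ha hzc hc hT0 hT hf hg).congr' (by
        filter_upwards [self_mem_nhdsWithin] with t ht using (E₂_eq ht).symm)
    exact (continuousWithinAt_Ioi_iff_Ici.1 h).mono fun t ht => ht.1
  · have h := hu.isTransportSolution.continuousOn_energy_Ioc (c := c)
      (hu.hasLocallyUniformSupport ha hzc hc hT hf hg) t ⟨h0, ht.2⟩
    have h' : ContinuousWithinAt (energy c u) (Icc 0 T) t := by
      refine h.mono_of_mem_nhdsWithin ?_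
      filter_upwards [self_mem_nhdsWithin, mem_nhdsWithin_of_mem_nhds (Ioi_mem_nhds h0)]
        with τ h1 h2 using ⟨h2, h1.2⟩
    refine h'.congr_of_eventuallyEq ?_ (E₂_eq h0)
    filter_upwards [mem_nhdsWithin_of_mem_nhds (Ioi_mem_nhds h0)] with τ hτ using E₂_eq hτ

/-- A continuous upper bound of the second energy extends to the horizon. -/
theorem IsSolution.E₂_le_of_energy_le (hT0 : 0 < T) (hT : zc + T < 0) (hf : IsTest f)
    (hg : IsTest g) (hu : IsSolution a l zc T f g u) {r : ℝ} (hr : 0 < r) {φ : ℝ → ℝ}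
    (hφ : Continuous φ) (h : ∀ t ∈ Ioc 0 r, energy c u t ≤ φ t) :
    ∀ t ∈ Icc 0 r, E₂ c u t ≤ φ t := by
  intro t ht
  rcases eq_or_lt_of_le ht.1 with rfl | h0
  · refine le_of_tendsto_of_tendsto (hu.tendsto_energy ha hzc hc hT0 hT hf hg)
      ((hφ.tendsto 0).mono_left nhdsWithin_le_nhds) ?_
    filter_upwards [Ioc_mem_nhdsGT hr] with τ hτ using h τ hτ
  · rw [E₂_eq h0]
    exact h t ⟨h0, ht.2⟩

/-- The near monotonicity of the second energy, up to the horizon. -/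
theorem IsCauchyHorizon.exists_E₂_near :
    ∃ δ > 0, δ ≤ 1 ∧ ∃ k > 0, ∀ T, 0 < T → zc + T < 0 →
      ∀ (f : ℝ → Fin 5 → ℝ) (g : ℝ → ℝ), IsTest f →
      IsTest g → ∀ u : ℝ → ℝ → Fin 5 → ℝ, IsSolution a l zc T f g u →
      ∀ t₂ ∈ Ioc 0 (min δ T), ∀ t ∈ Icc 0 t₂,
        E₂ c u t ≤ E₂ c u t₂ + k * t₂ * (t₂ - t) * ∫ p, g p ^ 2 := by
  obtain ⟨δ, hδ, k, hk, hnear⟩ := hzc.exists_energy_near_solution ha hc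
  refine ⟨min δ 1, lt_min hδ one_pos, min_le_right _ _, k, hk, ?_⟩
  intro T hT0 hT f g hf hg u hu t₂ ht₂
  refine hu.E₂_le_of_energy_le ha hzc hc hT0 hT hf hg ht₂.1 (by fun_prop) fun t ht => ?_
  rw [E₂_eq ht₂.1]
  refine hnear T hT0 hT f g hf hg u hu t t₂ ht.1 ht.2 (ht₂.2.trans ?_)
  exact min_le_min_right _ (min_le_left _ _)

theorem IsSolution.E₂_nonneg (hT0 : 0 < T) (hT : zc + T < 0) (hf : IsTest f)
    (hg : IsTest g) (hu : IsSolution a l zc T f g u) {t : ℝ} (ht : 0 ≤ t) : 0 ≤ E₂ c u t := by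
  rcases eq_or_lt_of_le ht with rfl | h0
  · refine ge_of_tendsto (hu.tendsto_energy ha hzc hc hT0 hT hf hg) ?_
    filter_upwards [self_mem_nhdsWithin] with t ht using energy_nonneg ht u
  · rw [E₂_eq h0]
    exact energy_nonneg h0 u

/-- The weighted second energy attains its maximum away from the horizon. -/
theorem IsSolution.exists_E₂_le_mul_exp (hT0 : 0 < T) (hT : zc + T < 0) (hf : IsTest f)
    (hg : IsTest g) (hu : IsSolution a l zc T f g u) {μ : ℝ} (hμ : 0 < μ) :
    ∃ t₂ ∈ Ioc 0 T, ∀ t ∈ Icc 0 t₂, E₂ c u t ≤ E₂ c u t₂ * Real.exp (μ * (t₂ - t)) := by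
  suffices h : ∃ t₂ ∈ Ioc 0 T, ∀ t ∈ Icc 0 T,
      E₂ c u t * Real.exp (μ * t) ≤ E₂ c u t₂ * Real.exp (μ * t₂) by
    obtain ⟨t₂, ht₂, h⟩ := h
    refine ⟨t₂, ht₂, fun t ht => ?_⟩
    rw [mul_sub, Real.exp_sub, mul_div_assoc', le_div_iff₀ (Real.exp_pos _)]
    exact h t ⟨ht.1, ht.2.trans ht₂.2⟩
  -- A maximum point of `E₂ e^(μt)` on the compact interval serves as `t₂` unless it is 0.
  obtain ⟨tm, htm, hmax⟩ := isCompact_Icc.exists_isMaxOn (nonempty_Icc.2 hT0.le)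
    ((hu.continuousOn_E₂ ha hzc hc hT0 hT hf hg).mul
      (by fun_prop : ContinuousOn (fun t => Real.exp (μ * t)) (Icc 0 T)))
  rcases eq_or_lt_of_le htm.1 with rfl | h0
  swap
  · exact ⟨tm, ⟨h0, htm.2⟩, fun t ht => hmax ht⟩
  have hmax' : ∀ t ∈ Icc 0 T, E₂ c u t * Real.exp (μ * t) ≤ E₂ c u 0 := by
    intro t ht
    simpa using hmax ht
  have hnn := fun t (ht : (0 : ℝ) ≤ t) => hu.E₂_nonneg ha hzc hc hT0 hT hf hg ht
  rcases eq_or_lt_of_le (hnn 0 le_rfl) with hz | hpos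
  · refine ⟨T, ⟨hT0, le_rfl⟩, fun t ht => (hmax' t ht).trans ?_⟩
    rw [← hz]
    exact mul_nonneg (hnn T hT0.le) (Real.exp_pos _).le
  obtain ⟨δ, hδ, -, k, hk, hnear⟩ := hzc.exists_E₂_near ha hc
  set Γ := ∫ p, g p ^ 2
  have hΓ0 : 0 ≤ Γ := integral_nonneg fun p => sq_nonneg _
  set m := E₂ c u 0
  -- If the maximum sits at 0 with value `m > 0`, then `E₂(r) ≥ m - kr²Γ`, while the exponential
  -- gains at least the factor `1 + μr`. The linear gain beats the quadratic loss as soon as `r B ≤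
  -- μ m`, so the maximum is also attained at `r > 0`. The extra factor `t₂` in the
  -- near-monotonicity bound is what makes this work.
  set B := k * Γ * (1 + μ * T) + 1 with hB
  have hB0 : 0 < B := by positivity
  set r := min (min δ T) (μ * m / B) with hr
  have hr0 : 0 < r := lt_min (lt_min hδ hT0) (by positivity)
  have hrT : r ≤ T := (min_le_left _ _).trans (min_le_right _ _)
  refine ⟨r, ⟨hr0, hrT⟩, fun t ht => (hmax' t ht).trans ?_⟩
  have h1 := hnear T hT0 hT f g hf hg u hu r ⟨hr0, min_le_left _ _⟩ 0 ⟨le_rfl, hr0.le⟩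
  have h2 : r * B ≤ μ * m := (le_div_iff₀ hB0).1 (min_le_right _ _)
  have h3 : μ * r + 1 ≤ Real.exp (μ * r) := Real.add_one_le_exp _
  have h4 := mul_le_mul_of_nonneg_left h3 (hnn r hr0.le)
  refine le_trans ?_ h4
  have h5 : (m - k * r * r * Γ) * (μ * r + 1) ≤ E₂ c u r * (μ * r + 1) :=
    mul_le_mul_of_nonneg_right (by linarith) (by positivity)
  refine le_trans ?_ h5
  have h6 : k * Γ * (1 + μ * r) ≤ B := by
    have : k * Γ * (1 + μ * r) ≤ k * Γ * (1 + μ * T) :=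
      mul_le_mul_of_nonneg_left (by nlinarith) (by positivity)
    linarith
  have h7 : r * (r * (k * Γ * (1 + μ * r))) ≤ r * (μ * m) :=
    mul_le_mul_of_nonneg_left ((mul_le_mul_of_nonneg_left h6 hr0.le).trans h2) hr0.le
  linarith

theorem IsCauchyHorizon.exists_energy_bound_solution (hT0 : 0 < T) (hT : zc + T < 0) :
    ∃ ν > 0, ∀ (f : ℝ → Fin 5 → ℝ) (g : ℝ → ℝ), IsTest f → IsTest g →
      ∀ u : ℝ → ℝ → Fin 5 → ℝ, IsSolution a l zc T f g u →
      ∀ t ∈ Ioc 0 T, energy c u t ≤ ν * (E₁ c u T + ∫ p, g p ^ 2) := by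
  obtain ⟨M, hM, hcoef⟩ := hzc.exists_coefficient_bound ha hc hT
  obtain ⟨ν, hν, hbound⟩ := hzc.exists_energy_bound ha hc hM.le hT0
    fun t ht => ⟨(hcoef t ht).1, (hcoef t ht).2.1⟩
  refine ⟨ν * max 1 T, by positivity, fun f g hf hg u hu t ht => ?_⟩
  have h1 := hbound _ u (fun p => |g p|) hu.isTransportSolution
    (hu.hasLocallyUniformSupport ha hzc hc hT hf hg)
    (by simpa only [sq_abs] using hg.integrable_sq)
    (fun t ht => sourceBound_of_source (hcoef t ht).2.2.1 (hcoef t ht).2.2.2) t ht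
  simp only [sq_abs] at h1
  have hTT : T ∈ Ioc 0 T := ⟨hT0, le_rfl⟩
  have h2 := energy_le_E₁ (c := c) hT0 (hu.isTransportSolution.continuous_slice hTT)
    (hu.exists_slice_support ha hzc hc hT hf hg hTT)
  have hΓ0 : 0 ≤ ∫ p, g p ^ 2 := integral_nonneg fun p => sq_nonneg _
  have h3 := mul_le_mul_of_nonneg_right (le_max_left 1 T) hΓ0
  have h4 : energy c u T + ∫ p, g p ^ 2 ≤ max 1 T * (E₁ c u T + ∫ p, g p ^ 2) := by linarith
  have h5 := mul_le_mul_of_nonneg_left h4 hν.le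
  linarith

end Main

end LTB

theorem mainTheorem7 (a : ℝ) (ha : 0 < a) (ha' : a < LTB.aStar) (l : ℕ) (zc c : ℝ)
    (hzc : LTB.IsCauchyHorizon a zc) (hc : LTB.IsExponent a l zc c) :
    -- the first energy is at most `μ / t` near the Cauchy horizon
    (∃ tStar > 0, ∀ t₁ : ℝ, 0 < t₁ → zc + t₁ < 0 →
      ∀ (f : ℝ → Fin 5 → ℝ) (g : ℝ → ℝ), LTB.IsTest f → LTB.IsTest g →
      ∃ μ > 0, ∀ u : ℝ → ℝ → Fin 5 → ℝ, LTB.IsSolution a l zc t₁ f g u →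
        ∀ t ∈ Ioc 0 (min tStar t₁), LTB.E₁ c u t ≤ μ / t) ∧
    -- the exponential bound for the second energy near the Cauchy horizon
    (∃ μ > 0, ∃ tStar > 0, ∀ t₁ : ℝ, 0 < t₁ → zc + t₁ < 0 →
      ∀ (f : ℝ → Fin 5 → ℝ) (g : ℝ → ℝ), LTB.IsTest f → LTB.IsTest g →
      ∀ u : ℝ → ℝ → Fin 5 → ℝ, LTB.IsSolution a l zc t₁ f g u →
        (∃ t₂ ∈ Ioc 0 t₁, ∀ t ∈ Icc 0 t₂,
          LTB.E₂ c u t ≤ LTB.E₂ c u t₂ * Real.exp (μ * (t₂ - t))) ∧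
        ∀ t₂ ∈ Ioc 0 (min tStar t₁), ∀ t ∈ Icc 0 t₂,
          LTB.E₂ c u t ≤ (LTB.E₂ c u t₂ + μ * (t₂ - t) * ∫ p, g p ^ 2)
            * Real.exp (μ * (t₂ - t))) ∧
    -- the a priori bound on the whole range, including the Cauchy horizon
    (∀ t₁ : ℝ, 0 < t₁ → zc + t₁ < 0 → ∃ ν > 0,
      ∀ (f : ℝ → Fin 5 → ℝ) (g : ℝ → ℝ), LTB.IsTest f → LTB.IsTest g →
      ∀ u : ℝ → ℝ → Fin 5 → ℝ, LTB.IsSolution a l zc t₁ f g u →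
        ContinuousOn (LTB.E₂ c u) (Icc 0 t₁) ∧
        (∀ t ∈ Icc 0 t₁, LTB.E₂ c u t ≤ ν * (LTB.E₁ c u t₁ + ∫ p, g p ^ 2)) ∧
        (LTB.EinsteinConstraint a l (zc + t₁) f g →
          ∀ t ∈ Icc 0 t₁, LTB.E₂ c u t ≤ ν * LTB.E₁ c u t₁)) := by
  refine ⟨⟨1, one_pos, fun t₁ h0 h1 f g hf hg => ?_⟩, ?_, fun t₁ h0 h1 => ?_⟩
  · obtain ⟨ν, hν, hbound⟩ := hzc.exists_energy_bound_solution ha hc h0 h1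
    have hE0 : 0 ≤ LTB.E₁ c (fun _ => f) t₁ := LTB.E₁_nonneg h0
    have hΓ0 : 0 ≤ ∫ p, g p ^ 2 := integral_nonneg fun p => sq_nonneg _
    -- The constant must be chosen before `u`. Since `u t₁ = f`, the initial energy can be computed
    -- from the constant-in-time field `f`; the added 1 makes it positive.
    refine ⟨ν * (LTB.E₁ c (fun _ => f) t₁ + (∫ p, g p ^ 2) + 1), by positivity, fun u hu t ht => ?_⟩
    have ht' : t ∈ Ioc 0 t₁ := ⟨ht.1, ht.2.trans (min_le_right _ _)⟩
    have h2 := hbound f g hf hg u hu t ht'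
    have h3 := LTB.mul_E₁_le_energy (c := c) ht.1 (ht.2.trans (min_le_left _ _))
      (hu.isTransportSolution.continuous_slice ht')
      (hu.exists_slice_support ha hzc hc h1 hf hg ht')
    have h4 : LTB.E₁ c u t₁ = LTB.E₁ c (fun _ => f) t₁ := by
      rw [LTB.E₁_eq h0, LTB.E₁_eq h0, hu.initial]
    rw [h4] at h2
    rw [le_div_iff₀ ht.1]
    linarith
  · obtain ⟨δ, hδ, hδ1, k, hk, hnear⟩ := hzc.exists_E₂_near ha hc
    refine ⟨k, hk, δ, hδ, fun t₁ h0 h1 f g hf hg u hu =>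
      ⟨hu.exists_E₂_le_mul_exp ha hzc hc h0 h1 hf hg hk, fun t₂ ht₂ t ht => ?_⟩⟩
    have hΓ0 : 0 ≤ ∫ p, g p ^ 2 := integral_nonneg fun p => sq_nonneg _
    have hd : 0 ≤ t₂ - t := sub_nonneg.2 ht.2
    have h2 := hnear t₁ h0 h1 f g hf hg u hu t₂ ht₂ t ht
    -- As `t₂ ≤ δ ≤ 1`, the factor `t₂` may be dropped, and `μ = k` serves both claims; the
    -- exponential is then at least 1 and multiplies a nonnegative quantity.
    have h3 : k * t₂ * (t₂ - t) * ∫ p, g p ^ 2 ≤ k * (t₂ - t) * ∫ p, g p ^ 2 := by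
      refine mul_le_mul_of_nonneg_right (mul_le_mul_of_nonneg_right ?_ hd) hΓ0
      exact mul_le_of_le_one_right hk.le ((ht₂.2.trans (min_le_left _ _)).trans hδ1)
    have h4 := hu.E₂_nonneg ha hzc hc h0 h1 hf hg ht₂.1.le
    refine (h2.trans (add_le_add_right h3 _)).trans (le_mul_of_one_le_right ?_ ?_)
    · positivity
    · exact Real.one_le_exp (by positivity)
  · obtain ⟨ν, hν, hbound⟩ := hzc.exists_energy_bound_solution ha hc h0 h1
    obtain ⟨ν', hν', hbound'⟩ := hzc.exists_energy_bound_of_constraint ha hc h0 h1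
    refine ⟨max ν ν', lt_max_of_lt_left hν, fun f g hf hg u hu =>
      ⟨hu.continuousOn_E₂ ha hzc hc h0 h1 hf hg, ?_, fun hE => ?_⟩⟩
    · refine hu.E₂_le_of_energy_le ha hzc hc h0 h1 hf hg h0 continuous_const fun t ht => ?_
      refine (hbound f g hf hg u hu t ht).trans
        (mul_le_mul_of_nonneg_right (le_max_left _ _) ?_)
      exact add_nonneg (LTB.E₁_nonneg h0) (integral_nonneg fun p => sq_nonneg _)
    · refine hu.E₂_le_of_energy_le ha hzc hc h0 h1 hf hg h0 continuous_const fun t ht => ?_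
      exact (hbound' f g hf hg u hu hE t ht).trans
        (mul_le_mul_of_nonneg_right (le_max_right _ _) (LTB.E₁_nonneg h0))
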